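/- For a complex number $z$ put $\gamma_\infty(z)=\pi^{-z/2}\,\Gamma(z/2)$, for a prime $p$ put $\gamma_p(z)=(1-p^{-z})^{-1}$, and for a place $v$ of $\mathbb{Q}$ let $\rho_v(z)=\gamma_v(z)/\gamma_v(1-z)$. Let $\mathbb{C}_-=\{z\in\mathbb{C} : \operatorname{Re} z\le \tfrac12\}$, with boundary the critical line $\partial\mathbb{C}_-=\{\operatorname{Re} z=\tfrac12\}$ equipped with arc length. Let $P$ be the orthogonal projection of $L^2(\partial\mathbb{C}_-)$ onto the Hardy space $H^2(\mathbb{C}_-)$, the space of $L^2$ boundary values of the functions $G$ holomorphic on $\{\operatorname{Re} z<\tfrac12\}$ with $\sup_{x<1/2}\int_{\mathbb{R}}|G(x+is)|^2\,ds<\infty$. A function $u\in L^\infty(\partial\mathbb{C}_-)$ is called quasi-inner relative to $\mathbb{C}_-$ if $|u|=1$ almost everywhere and the operator $(1-P)uP$ on $L^2(\partial\mathbb{C}_-)$ is compact, where $u$ acts by multiplication. A bounded operator $T$ on a Hilbert space is called an infinitesimal of order $\alpha>0$ if it is compact and its characteristic values $\mu_n(T)=\inf\{\|T-R\| : \operatorname{rank}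 R\le n\}$ satisfy $\mu_n(T)=O(n^{-\alpha})$ as $n\to\infty$. **Theorem.** Let $F$ be a finite set of places of $\mathbb{Q}$ that contains the archimedean place, and let $m\ge 0$ be the number of primes in $F$, so that $F$ has $m+1$ elements. Then the restriction to the critical line of $$u=\prod_{v\in F}\rho_v=\rho_\infty\prod_{p\in F}\rho_p$$ is quasi-inner relative to $\mathbb{C}_-$. Moreover, the off-diagonal part $(1-P)uP$ is an infinitesimal of order $\frac{1}{2m}$ if $m\ge 1$, and an infinitesimal of order $\alpha$ for every $\alpha>0$ if $m=0$. -/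

import Mathlib

open MeasureTheory Filter Topology
open scoped ENNReal

noncomputable section

namespace QuasiInner

/-- The places of `ℚ`: the archimedean place, and one place for each prime number. -/
inductive Place where
  | archimedean : Place
  | prime (p : Nat.Primes) : Place

/-- The local `L`-factors `γ_v`. At the archimedean place `Complex.Gammaℝ z` is
`π ^ (-z / 2) * Γ(z / 2)`. -/
def localFactor : Place → ℂ → ℂ
  | .archimedean, z => Complex.Gammaℝ z
  | .prime p, z => (1 - ((p : ℕ) : ℂ) ^ (-z))⁻¹

/-- The ratio `ρ_v(z) = γ_v(z) / γ_v(1 - z)`. -/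
def localRatio (v : Place) (z : ℂ) : ℂ :=
  localFactor v z / localFactor v (1 - z)

/-- The product of the ratios `ρ_v` over a finite set of places. -/
def ratioProduct (F : Finset Place) (z : ℂ) : ℂ :=
  ∏ v ∈ F, localRatio v z

/-- The point `x + i s` of the vertical line `Re z = x`. -/
def linePoint (x s : ℝ) : ℂ := (x : ℂ) + (s : ℂ) * Complex.I

/-- `L²` of the critical line `Re z = 1/2` for arc length, the line being parametrized by
`s ↦ 1/2 + i s`. -/
abbrev BoundaryL2 : Type := Lp ℂ 2 (volume : Measure ℝ)

/-- `L^∞` of the critical line, in the same parametrization. -/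
abbrev BoundaryLinfty : Type := Lp ℂ ∞ (volume : Measure ℝ)

/-- `G` is a holomorphic function on the open half-plane `Re z < 1/2` whose `L²` norms on the
vertical lines are bounded, and `f` is its boundary value on the critical line. -/
structure IsHardyExtension (G : ℂ → ℂ) (f : ℝ → ℂ) : Prop where
  holomorphic : DifferentiableOn ℂ G {z : ℂ | z.re < 1 / 2}
  bounded : ∃ C : ℝ≥0∞, C < ∞ ∧
    ∀ x : ℝ, x < 1 / 2 → eLpNorm (fun s : ℝ => G (linePoint x s)) 2 volume ≤ C
  boundary : Tendsto (fun x : ℝ => eLpNorm (fun s : ℝ => G (linePoint x s) - f s) 2 volume)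
    (𝓝[<] (1 / 2)) (𝓝 0)

theorem continuous_on_line {G : ℂ → ℂ} (hG : DifferentiableOn ℂ G {z : ℂ | z.re < 1 / 2})
    {x : ℝ} (hx : x < 1 / 2) : Continuous fun s : ℝ => G (linePoint x s) := by
  refine hG.continuousOn.comp_continuous (by unfold linePoint; fun_prop) fun s => ?_
  simpa [linePoint] using hx

theorem IsHardyExtension.congr {G : ℂ → ℂ} {f g : ℝ → ℂ} (h : IsHardyExtension G f)
    (hfg : f =ᵐ[volume] g) : IsHardyExtension G g := by
  refine ⟨h.holomorphic, h.bounded, h.boundary.congr fun x => eLpNorm_congr_ae ?_⟩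
  filter_upwards [hfg] with s hs
  rw [hs]

theorem IsHardyExtension.add {G H : ℂ → ℂ} {f g : ℝ → ℂ} (hf : AEStronglyMeasurable f volume)
    (hg : AEStronglyMeasurable g volume)
    (hG : IsHardyExtension G f) (hH : IsHardyExtension H g) :
    IsHardyExtension (G + H) (f + g) := by
  obtain ⟨C, hC, hGC⟩ := hG.bounded
  obtain ⟨D, hD, hHD⟩ := hH.bounded
  refine ⟨hG.holomorphic.add hH.holomorphic, ⟨C + D, ENNReal.add_lt_top.2 ⟨hC, hD⟩, ?_⟩, ?_⟩
  · intro x hx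
    exact (eLpNorm_add_le (continuous_on_line hG.holomorphic hx).aestronglyMeasurable
      (continuous_on_line hH.holomorphic hx).aestronglyMeasurable (by norm_num)).trans
      (add_le_add (hGC x hx) (hHD x hx))
  · have hsum := hG.boundary.add hH.boundary
    rw [add_zero] at hsum
    refine tendsto_of_tendsto_of_tendsto_of_le_of_le' tendsto_const_nhds hsum
      (Eventually.of_forall fun _ => zero_le) ?_
    filter_upwards [self_mem_nhdsWithin] with x hx
    have key := eLpNorm_add_le (p := 2)
      ((continuous_on_line hG.holomorphic hx).aestronglyMeasurable (μ := volume) |>.sub hf)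
      ((continuous_on_line hH.holomorphic hx).aestronglyMeasurable (μ := volume) |>.sub hg)
      (by norm_num)
    refine le_trans (le_of_eq (congrArg (fun k : ℝ → ℂ => eLpNorm k 2 volume) ?_)) key
    funext s
    simp only [Pi.add_apply, Pi.sub_apply]
    ring

theorem IsHardyExtension.smul (c : ℂ) {G : ℂ → ℂ} {f : ℝ → ℂ} (hG : IsHardyExtension G f) :
    IsHardyExtension (c • G) (c • f) := by
  obtain ⟨C, hC, hGC⟩ := hG.bounded
  refine ⟨hG.holomorphic.const_smul c, ⟨‖c‖ₑ * C, ENNReal.mul_lt_top enorm_lt_top hC, ?_⟩, ?_⟩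
  · intro x hx
    have h1 : (fun s : ℝ => (c • G) (linePoint x s)) = c • fun s : ℝ => G (linePoint x s) := rfl
    rw [h1, eLpNorm_const_smul]
    gcongr
    exact hGC x hx
  · have h0 := ENNReal.Tendsto.const_mul (a := ‖c‖ₑ) hG.boundary (Or.inr enorm_ne_top)
    rw [mul_zero] at h0
    refine h0.congr fun x => ?_
    rw [← eLpNorm_const_smul]
    congr 1
    funext s
    simp [mul_sub]

/-- The Hardy space `H²` of the half-plane `Re z < 1/2`, as a space of boundary values in
`L²` of the critical line. -/
def hardySpace : Submodule ℂ BoundaryL2 where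
  carrier := {f | ∃ G : ℂ → ℂ, IsHardyExtension G f}
  zero_mem' := by
    refine ⟨0, IsHardyExtension.congr (f := 0) ⟨differentiableOn_const 0, ⟨0, by simp, ?_⟩, ?_⟩
      (Lp.coeFn_zero ℂ 2 volume).symm⟩
    · intro x _
      simp
    · simp
  add_mem' := by
    rintro f g ⟨G, hG⟩ ⟨H, hH⟩
    exact ⟨G + H, (hG.add (Lp.aestronglyMeasurable f) (Lp.aestronglyMeasurable g) hH).congr
      (Lp.coeFn_add f g).symm⟩
  smul_mem' := by
    rintro c f ⟨G, hG⟩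
    exact ⟨c • G, (hG.smul c).congr (Lp.coeFn_smul c f).symm⟩

/-- The orthogonal projection `P` of `L²` of the critical line onto the Hardy space. The Hardy
space is closed, so passing to its closure changes nothing; it only gives the completeness on
which the existence of the projection rests. -/
def hardyProjection : BoundaryL2 →L[ℂ] BoundaryL2 :=
  hardySpace.topologicalClosure.starProjection

/-- Multiplication by `u ∈ L^∞` as an operator on `L²`. -/
def multiplication (u : BoundaryLinfty) : BoundaryL2 →L[ℂ] BoundaryL2 :=
  (ContinuousLinearMap.mul ℂ ℂ).holderL volume ∞ 2 2 u

/-- The off-diagonal part `(1 - P) u P`. -/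
def offDiagonal (u : BoundaryLinfty) : BoundaryL2 →L[ℂ] BoundaryL2 :=
  (ContinuousLinearMap.id ℂ BoundaryL2 - hardyProjection) ∘L multiplication u ∘L hardyProjection

/-- `u ∈ L^∞` of the critical line is quasi-inner relative to the half-plane `Re z ≤ 1/2`. -/
def IsQuasiInner (u : BoundaryLinfty) : Prop :=
  (∀ᵐ s : ℝ, ‖u s‖ = 1) ∧ IsCompactOperator (offDiagonal u)

/-- The characteristic value `μ_n(T)`: the distance from `T` to the operators of rank at
most `n`. For compact `T` on a Hilbert space these are the eigenvalues of `|T|` in decreasing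
order, with `μ_0(T) = ‖T‖`. -/
def characteristicValue {H : Type*} [NormedAddCommGroup H] [InnerProductSpace ℂ H] (n : ℕ)
    (T : H →L[ℂ] H) : ℝ :=
  sInf {r : ℝ | ∃ R : H →L[ℂ] H, LinearMap.rank (R : H →ₗ[ℂ] H) ≤ (n : Cardinal) ∧ r = ‖T - R‖}

/-- An infinitesimal of order `α`: a compact operator with `μ_n(T) = O(n ^ (-α))`. -/
def IsInfinitesimalOfOrder {H : Type*} [NormedAddCommGroup H] [InnerProductSpace ℂ H] (α : ℝ)
    (T : H →L[ℂ] H) : Prop :=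
  IsCompactOperator T ∧
    (fun n : ℕ => characteristicValue n T) =O[atTop] fun n : ℕ => (n : ℝ) ^ (-α)

end QuasiInner

end

namespace QuasiInner

/-! ### Multipliers of the Hardy space -/

/-! The off-diagonal part `(1 - P) u P` measures how far multiplication by `u` is from preserving
`H²`. A symbol that is bounded and holomorphic on the half-plane contributes nothing. A simple pole
`(z - a)⁻¹` with `Re a < 1/2` contributes rank at most one, since division by `z - a` keeps a Hardy
function in `H²` when the function vanishes at `a`. Hence a symbol that is uniformly within `ε` of
`k` simple poles plus a bounded holomorphic function has `μ_k ≤ ε`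
(`exists_rank_le_norm_offDiagonal_sub_le`).

On the critical line `q ^ (-z) ρ_∞(z) = Γ(z) (2πiq) ^ (-z) + Γ(z) (-2πiq) ^ (-z)`, and each summand
is the Mellin transform of an oscillating exponential `exp (-a x)`. The integral over `(1, ∞)` is
holomorphic for `Re z < 1`; the two of them together are bounded on `Re z ≤ 1/2` by
Phragmén–Lindelöf (`norm_holomorphicPart_le`). Over `(0, 1]` the Taylor series of the exponential
gives poles at `0, -1, -2, …`, and keeping `k` of them leaves an error of size `(2πq) ^ k / k!` once
`k` is large compared with `q`.

At the primes, `∏ (1 - p ^ (-z))⁻¹` is replaced by truncated geometric series, with error `O(X ^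
(-1/2))`. The resulting terms `q ^ (-z)` have `q ≤ X ^ m`, and all of them share the same poles, so
`k = 32 X ^ m` poles suffice for all of them at once (`exists_poles_add_holomorphic`). The
numerators `1 - p ^ (z - 1)` are bounded and holomorphic on the half-plane and factor out on the
right. An error `X ^ (-1/2)` at rank about `X ^ m` is the order `1 / (2m)`. Without primes only the
factorial error is left, and it decays faster than any power. -/

theorem re_linePoint (x s : ℝ) : (linePoint x s).re = x := by simp [linePoint]

theorem im_linePoint (x s : ℝ) : (linePoint x s).im = s := by simp [linePoint]

theorem continuous_linePoint (x : ℝ) : Continuous (linePoint x) := by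
  unfold linePoint; fun_prop

theorem continuous_linePoint_left (s : ℝ) : Continuous fun x => linePoint x s := by
  unfold linePoint; fun_prop

/-- Dominated convergence for a bounded family of multipliers. -/
theorem tendsto_eLpNorm_mul_sub_zero {l : Filter ℝ} [l.IsCountablyGenerated]
    {b : ℝ → ℝ → ℂ} {b₀ f : ℝ → ℂ} {C : ℝ} (hf : MemLp f 2 volume)
    (hbm : ∀ᶠ x in l, AEStronglyMeasurable (b x) volume) (hb₀ : AEStronglyMeasurable b₀ volume)
    (hb : ∀ᶠ x in l, ∀ s, ‖b x s‖ ≤ C) (hb₀C : ∀ s, ‖b₀ s‖ ≤ C)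
    (hlim : ∀ s, Tendsto (fun x => b x s) l (𝓝 (b₀ s))) :
    Tendsto (fun x => eLpNorm (fun s => (b x s - b₀ s) * f s) 2 volume) l (𝓝 0) := by
  have key : Tendsto (fun x => ∫⁻ s, ‖(b x s - b₀ s) * f s‖ₑ ^ (2 : ℝ)) l (𝓝 (∫⁻ _ : ℝ, 0)) := by
    -- Both multipliers are at most `C` in norm, so `(2C)² |f|²` dominates.
    refine tendsto_lintegral_filter_of_dominated_convergence'
      (fun s => ‖(2 * C : ℝ)‖ₑ ^ (2 : ℝ) * ‖f s‖ₑ ^ (2 : ℝ)) ?_ ?_ ?_ ?_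
    · filter_upwards [hbm] with x hx
      exact ((hx.sub hb₀).mul hf.1).enorm.pow_const _
    · filter_upwards [hb] with x hx
      refine Eventually.of_forall fun s => ?_
      rw [enorm_mul, ENNReal.mul_rpow_of_nonneg _ _ (by norm_num)]
      gcongr
      rw [enorm_le_iff_norm_le]
      have hC : 0 ≤ C := (norm_nonneg _).trans (hb₀C s)
      rw [Real.norm_of_nonneg (by positivity)]
      exact (norm_sub_le _ _).trans (by linarith [hx s, hb₀C s])
    · rw [lintegral_const_mul' _ _ (ENNReal.rpow_ne_top_of_nonneg (by norm_num) enorm_ne_top)]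
      have := hf.eLpNorm_lt_top
      rw [eLpNorm_lt_top_iff_lintegral_rpow_enorm_lt_top (by norm_num) (by norm_num)] at this
      exact ENNReal.mul_ne_top (ENNReal.rpow_ne_top_of_nonneg (by norm_num) enorm_ne_top)
        (by simpa using this.ne)
    · refine Eventually.of_forall fun s => ?_
      have h1 : Tendsto (fun x => (b x s - b₀ s) * f s) l (𝓝 0) := by
        simpa using ((hlim s).sub_const (b₀ s)).mul_const (f s)
      have h2 := (ENNReal.continuous_rpow_const (y := (2 : ℝ))).tendsto _ |>.comp h1.enorm
      simpa [Function.comp_def] using h2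
  have h3 := (ENNReal.continuous_rpow_const (y := (1 / 2 : ℝ))).tendsto _ |>.comp key
  simp only [lintegral_zero] at h3
  rw [ENNReal.zero_rpow_of_pos (by norm_num)] at h3
  refine h3.congr fun x => ?_
  rw [eLpNorm_eq_lintegral_rpow_enorm_toReal (by norm_num) (by norm_num)]
  simp

/-- The product of a Hardy function `G` by a function `b`, bounded near the boundary, is a Hardy
function if it extends to a holomorphic function `H` that is dominated by `G` outside of a
horizontal strip, and by `G` plus a constant in this strip. -/
theorem IsHardyExtension.of_dominated {G H b : ℂ → ℂ} {f : ℝ → ℂ} (hf : MemLp f 2 volume)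
    (hG : IsHardyExtension G f) (hH : DifferentiableOn ℂ H {z : ℂ | z.re < 1 / 2})
    {C M t r δ : ℝ}
    (hHG : ∀ z : ℂ, z.re < 1 / 2 →
      ‖H z‖ ≤ C * ‖G z‖ + (Set.Icc (t - r) (t + r)).indicator (fun _ => M) z.im)
    (hδ : δ < 1 / 2) (hHb : ∀ z : ℂ, δ < z.re → z.re < 1 / 2 → H z = b z * G z)
    (hb : ∀ z : ℂ, δ < z.re → z.re ≤ 1 / 2 → ContinuousAt b z)
    (hbC : ∀ z : ℂ, δ < z.re → z.re ≤ 1 / 2 → ‖b z‖ ≤ C) :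
    IsHardyExtension H (fun s => b (linePoint (1 / 2) s) * f s) := by
  have hmem : ∀ᶠ x in 𝓝[<] (1 / 2 : ℝ), δ < x ∧ x < 1 / 2 := Ioo_mem_nhdsLT hδ
  have hbcont : ∀ x, δ < x → x ≤ 1 / 2 → Continuous fun s => b (linePoint x s) := fun x h1 h2 => by
    refine continuous_iff_continuousAt.2 fun s => ?_
    exact ContinuousAt.comp (f := linePoint x)
      (hb _ (by rwa [re_linePoint]) (by rwa [re_linePoint]))
      (continuous_linePoint x).continuousAt
  refine ⟨hH, ?_, ?_⟩
  · obtain ⟨D, hD, hGD⟩ := hG.bounded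
    set χ : ℝ → ℝ := (Set.Icc (t - r) (t + r)).indicator (fun _ => M)
    have hχ : MemLp χ 2 volume :=
      memLp_indicator_const 2 measurableSet_Icc M (Or.inr (by simp))
    refine ⟨‖C‖ₑ * D + eLpNorm χ 2 volume, ENNReal.add_lt_top.2
      ⟨ENNReal.mul_lt_top enorm_lt_top hD, hχ.eLpNorm_lt_top⟩, fun x hx => ?_⟩
    have hGc := continuous_on_line hG.holomorphic hx
    have h1 : eLpNorm (fun s => H (linePoint x s)) 2 volume ≤
        eLpNorm ((C • fun s => ‖G (linePoint x s)‖) + χ) 2 volume := by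
      refine eLpNorm_mono_real fun s => ?_
      simpa [im_linePoint] using hHG (linePoint x s) (by rwa [re_linePoint])
    refine h1.trans ((eLpNorm_add_le (hGc.norm.aestronglyMeasurable.const_smul C) hχ.1
      (by norm_num)).trans ?_)
    rw [eLpNorm_const_smul, eLpNorm_norm]
    gcongr
    exact hGD x hx
  · have h1 := ENNReal.Tendsto.const_mul (a := ‖C‖ₑ) hG.boundary (Or.inr enorm_ne_top)
    have h2 := tendsto_eLpNorm_mul_sub_zero (l := 𝓝[<] (1 / 2 : ℝ)) (C := C)
      (b := fun x s => b (linePoint x s)) (b₀ := fun s => b (linePoint (1 / 2) s)) hf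
      (hmem.mono fun x hx => (hbcont x hx.1 hx.2.le).aestronglyMeasurable)
      (hbcont _ hδ le_rfl).aestronglyMeasurable
      (hmem.mono fun x hx s => hbC _ (by rw [re_linePoint]; exact hx.1)
        (by rw [re_linePoint]; exact hx.2.le))
      (fun s => hbC _ (by rwa [re_linePoint]) (by rw [re_linePoint]))
      (fun s => ((ContinuousAt.comp (f := fun x => linePoint x s)
        (hb _ (by rwa [re_linePoint]) (by rw [re_linePoint]))
        (continuous_linePoint_left s).continuousAt).tendsto).mono_left nhdsWithin_le_nhds)
    have h3 := h1.add h2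
    rw [mul_zero, add_zero] at h3
    refine tendsto_of_tendsto_of_tendsto_of_le_of_le' tendsto_const_nhds h3
      (Eventually.of_forall fun _ => zero_le) ?_
    filter_upwards [hmem] with x hx
    have hGc := continuous_on_line hG.holomorphic hx.2
    have hbx := (hbcont x hx.1 hx.2.le).aestronglyMeasurable (μ := volume)
    have hb0 := (hbcont _ hδ le_rfl).aestronglyMeasurable (μ := volume)
    -- The error splits into `b_x (G_x - f)`, controlled by the boundary convergence of `G`, and
    -- `(b_x - b_0) f`, controlled by dominated convergence.
    have h4 : (fun s => H (linePoint x s) - b (linePoint (1 / 2) s) * f s) =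
        (fun s => b (linePoint x s) * (G (linePoint x s) - f s)) +
          fun s => (b (linePoint x s) - b (linePoint (1 / 2) s)) * f s := by
      funext s
      simp only [Pi.add_apply]
      rw [hHb _ (by rw [re_linePoint]; exact hx.1) (by rw [re_linePoint]; exact hx.2)]
      ring
    rw [h4]
    refine (eLpNorm_add_le (hbx.mul (hGc.aestronglyMeasurable.sub hf.1))
      ((hbx.sub hb0).mul hf.1) (by norm_num)).trans (add_le_add ?_ le_rfl)
    have h5 : ∀ s, ‖b (linePoint x s) * (G (linePoint x s) - f s)‖ ≤
        ‖(C : ℂ) • (G (linePoint x s) - f s)‖ := fun s => by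
      have hC := hbC (linePoint x s) (by rw [re_linePoint]; exact hx.1)
        (by rw [re_linePoint]; exact hx.2.le)
      rw [norm_mul, norm_smul, Complex.norm_real, Real.norm_of_nonneg ((norm_nonneg _).trans hC)]
      gcongr
    refine (eLpNorm_mono h5).trans (le_of_eq ?_)
    have := eLpNorm_const_smul (C : ℂ) (fun s => G (linePoint x s) - f s) 2 (volume : Measure ℝ)
    rw [show ‖(C : ℂ)‖ₑ = ‖C‖ₑ from by rw [← ofReal_norm, ← ofReal_norm, Complex.norm_real]] at this
    exact this

theorem multiplication_toLp_coeFn {a : ℝ → ℂ} (ha : MemLp a ∞ volume) (f : BoundaryL2) :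
    multiplication (ha.toLp a) f =ᵐ[volume] fun s => a s * f s := by
  have h := ContinuousLinearMap.coeFn_holder (r := 2) (ContinuousLinearMap.mul ℂ ℂ) (ha.toLp a) f
  filter_upwards [h, ha.coeFn_toLp] with s h1 h2
  change (ContinuousLinearMap.holder 2 (ContinuousLinearMap.mul ℂ ℂ) (ha.toLp a) f) s = _
  rw [h1, ContinuousLinearMap.mul_apply', h2]

theorem norm_multiplication_le (u : BoundaryLinfty) : ‖multiplication u‖ ≤ ‖u‖ := by
  refine ((ContinuousLinearMap.mul ℂ ℂ).holderL volume ∞ 2 2).le_of_opNorm_le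
    ((ContinuousLinearMap.norm_holderL_le _).trans (ContinuousLinearMap.opNorm_mul_le ℂ ℂ)) u
    |>.trans (by rw [one_mul])

/-- A bounded holomorphic function that is continuous up to the boundary multiplies the Hardy
space. -/
theorem multiplication_mem_hardySpace {b : ℂ → ℂ} {C : ℝ}
    (hb : DifferentiableOn ℂ b {z : ℂ | z.re < 1})
    (hbC : ∀ z : ℂ, z.re ≤ 1 / 2 → ‖b z‖ ≤ C)
    (hbL : MemLp (fun s : ℝ => b (linePoint (1 / 2) s)) ∞ volume)
    {f : BoundaryL2} (hf : f ∈ hardySpace) :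
    multiplication (hbL.toLp _) f ∈ hardySpace := by
  obtain ⟨G, hG⟩ := hf
  have hcont : ∀ z : ℂ, 0 < z.re → z.re ≤ 1 / 2 → ContinuousAt b z := fun z _ hz =>
    (hb.differentiableAt ((isOpen_lt Complex.continuous_re continuous_const).mem_nhds
      (by simp only [Set.mem_ofPred_eq]; linarith))).continuousAt
  refine ⟨fun z => b z * G z, IsHardyExtension.congr (IsHardyExtension.of_dominated (b := b)
    (C := C) (M := 0) (t := 0) (r := 0) (δ := 0) (Lp.memLp f) hG ?_ ?_ (by norm_num)
    (fun z _ _ => rfl) hcont (fun z _ hz => hbC z hz))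
    (multiplication_toLp_coeFn hbL f).symm⟩
  · exact (hb.mono fun z hz => lt_trans (Set.mem_ofPred_eq ▸ hz) (by norm_num)).mul hG.holomorphic
  · intro z hz
    rw [norm_mul]
    simp only [Set.indicator_zero, add_zero]
    gcongr
    exact hbC z hz.le

/-- Division of a Hardy function by `z - a`, at a zero `a` of the function. -/
theorem multiplication_inv_sub_mem_hardySpace {a : ℂ} (ha : a.re < 1 / 2)
    (hL : MemLp (fun s : ℝ => (linePoint (1 / 2) s - a)⁻¹) ∞ volume)
    {f : BoundaryL2} {G : ℂ → ℂ} (hG : IsHardyExtension G f) (hGa : G a = 0) :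
    multiplication (hL.toLp _) f ∈ hardySpace := by
  -- Half the distance from `a` to the critical line: the closed disc of radius `r` stays in the
  -- half-plane, and a strip next to the line stays outside the disc.
  set r : ℝ := (1 / 2 - a.re) / 2 with hr
  have hr0 : 0 < r := by rw [hr]; linarith
  have hopen : IsOpen {z : ℂ | z.re < 1 / 2} := isOpen_lt Complex.continuous_re continuous_const
  have hd : DifferentiableOn ℂ (dslope G a) {z : ℂ | z.re < 1 / 2} :=
    (Complex.differentiableOn_dslope (hopen.mem_nhds ha)).2 hG.holomorphic
  have hsub : Metric.closedBall a r ⊆ {z : ℂ | z.re < 1 / 2} := fun z hz => by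
    rw [Metric.mem_closedBall, dist_eq_norm] at hz
    have := (Complex.abs_re_le_norm (z - a)).trans hz
    rw [Complex.sub_re, abs_le] at this
    simp only [Set.mem_ofPred_eq]
    linarith [this.2]
  obtain ⟨M, hM⟩ := (isCompact_closedBall a r).exists_bound_of_continuousOn
    (hd.continuousOn.mono hsub)
  have hdsl : ∀ z, z ≠ a → dslope G a z = (z - a)⁻¹ * G z := fun z hz => by
    rw [dslope_of_ne _ hz, slope_def_field, hGa, sub_zero, div_eq_inv_mul]
  have hfar : ∀ z : ℂ, r < ‖z - a‖ → ‖(z - a)⁻¹‖ ≤ r⁻¹ := fun z hz => by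
    rw [norm_inv]
    gcongr
  have hgt : ∀ z : ℂ, a.re + r < z.re → r < ‖z - a‖ := fun z hz => by
    have := (le_abs_self _).trans (Complex.abs_re_le_norm (z - a))
    rw [Complex.sub_re] at this
    linarith
  refine ⟨dslope G a, IsHardyExtension.congr (IsHardyExtension.of_dominated
    (b := fun z => (z - a)⁻¹) (C := r⁻¹) (M := M) (t := a.im) (r := r) (δ := a.re + r)
    (Lp.memLp f) hG hd ?_ (by rw [hr]; linarith) ?_ ?_ ?_) (multiplication_toLp_coeFn hL f).symm⟩
  · intro z hz
    have hM0 : 0 ≤ M := (norm_nonneg _).trans (hM a (Metric.mem_closedBall_self hr0.le))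
    -- Inside the disc the quotient is bounded by compactness, and the disc lies in the horizontal
    -- strip; outside, `‖(z - a)⁻¹‖ ≤ r⁻¹`.
    rcases le_or_gt ‖z - a‖ r with h | h
    · have him := abs_le.1 ((Complex.abs_im_le_norm (z - a)).trans h)
      rw [Complex.sub_im] at him
      rw [Set.indicator_of_mem (by constructor <;> linarith [him.1, him.2])]
      have := hM z (by rwa [Metric.mem_closedBall, dist_eq_norm])
      have h2 : 0 ≤ r⁻¹ * ‖G z‖ := by positivity
      linarith
    · have hne : z ≠ a := by
        rintro rfl
        rw [sub_self, norm_zero] at h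
        linarith
      rw [hdsl z hne, norm_mul]
      refine (mul_le_mul_of_nonneg_right (hfar z h) (norm_nonneg _)).trans
        (le_add_of_nonneg_right (Set.indicator_nonneg (fun _ _ => hM0) _))
  · intro z hz _
    refine hdsl z ?_
    rintro rfl
    linarith
  · intro z hz _
    have : z - a ≠ 0 := norm_pos_iff.1 (hr0.trans (hgt z hz))
    fun_prop (disch := assumption)
  · intro z hz _
    exact hfar z (hgt z hz)

/-! ### Off-diagonal parts -/

theorem offDiagonal_add (u v : BoundaryLinfty) :
    offDiagonal (u + v) = offDiagonal u + offDiagonal v := by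
  simp [offDiagonal, multiplication, ContinuousLinearMap.add_comp, ContinuousLinearMap.comp_add]

theorem offDiagonal_smul (c : ℂ) (u : BoundaryLinfty) :
    offDiagonal (c • u) = c • offDiagonal u := by
  simp [offDiagonal, multiplication, ContinuousLinearMap.smul_comp]

theorem norm_offDiagonal_le (u : BoundaryLinfty) : ‖offDiagonal u‖ ≤ ‖u‖ := by
  have hP : ‖hardyProjection‖ ≤ 1 := Submodule.starProjection_norm_le _
  have hQ : ‖ContinuousLinearMap.id ℂ BoundaryL2 - hardyProjection‖ ≤ 1 := by
    have := Submodule.starProjection_norm_le (𝕜 := ℂ) hardySpace.topologicalClosureᗮ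
    rwa [Submodule.starProjection_orthogonal] at this
  calc ‖offDiagonal u‖ ≤ ‖ContinuousLinearMap.id ℂ BoundaryL2 - hardyProjection‖ *
        (‖multiplication u‖ * ‖hardyProjection‖) :=
        (ContinuousLinearMap.opNorm_comp_le _ _).trans
          (mul_le_mul_of_nonneg_left (ContinuousLinearMap.opNorm_comp_le _ _) (norm_nonneg _))
    _ ≤ 1 * (‖u‖ * 1) := by
        gcongr
        exact norm_multiplication_le u
    _ = ‖u‖ := by ring

theorem hardyProjection_apply_of_mem {f : BoundaryL2} (hf : f ∈ hardySpace.topologicalClosure) :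
    hardyProjection f = f :=
  Submodule.starProjection_eq_self_iff.2 hf

theorem hardyProjection_mem (f : BoundaryL2) :
    hardyProjection f ∈ hardySpace.topologicalClosure :=
  Submodule.starProjection_apply_mem _ f

theorem offDiagonal_apply_eq_zero {u : BoundaryLinfty} {f : BoundaryL2} (hf : f ∈ hardySpace)
    (huf : multiplication u f ∈ hardySpace) : offDiagonal u f = 0 := by
  simp only [offDiagonal, ContinuousLinearMap.comp_apply, sub_apply,
    ContinuousLinearMap.id_apply]
  rw [hardyProjection_apply_of_mem (hardySpace.le_topologicalClosure hf),
    hardyProjection_apply_of_mem (hardySpace.le_topologicalClosure huf), sub_self]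

/-- `P` projects onto the closure of the Hardy space, whereas the arguments with holomorphic
extensions concern its elements; continuity of `A` bridges the two. -/
theorem hardySpace_closure_induction {A : BoundaryL2 →L[ℂ] BoundaryL2}
    {V : Submodule ℂ BoundaryL2} (hV : IsClosed (V : Set BoundaryL2))
    (h : ∀ f ∈ hardySpace, A f ∈ V) {f : BoundaryL2} (hf : f ∈ hardySpace.topologicalClosure) :
    A f ∈ V := by
  have h1 : hardySpace.topologicalClosure ≤ V.comap (A : BoundaryL2 →ₗ[ℂ] BoundaryL2) :=
    Submodule.topologicalClosure_minimal _ (fun f hf => h f hf) (hV.preimage A.continuous)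
  exact h1 hf

theorem offDiagonal_apply_hardyProjection (u : BoundaryLinfty) (f : BoundaryL2) :
    offDiagonal u (hardyProjection f) = offDiagonal u f := by
  simp only [offDiagonal, ContinuousLinearMap.comp_apply]
  rw [hardyProjection_apply_of_mem (hardyProjection_mem f)]

theorem offDiagonal_apply_mem {u : BoundaryLinfty} {V : Submodule ℂ BoundaryL2}
    (hV : IsClosed (V : Set BoundaryL2)) (h : ∀ f ∈ hardySpace, offDiagonal u f ∈ V)
    (f : BoundaryL2) : offDiagonal u f ∈ V := by
  rw [← offDiagonal_apply_hardyProjection]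
  exact hardySpace_closure_induction hV h (hardyProjection_mem f)

/-- The off-diagonal part of a bounded holomorphic function vanishes. -/
theorem offDiagonal_eq_zero_of_holomorphic {b : ℂ → ℂ} {C : ℝ}
    (hb : DifferentiableOn ℂ b {z : ℂ | z.re < 1})
    (hbC : ∀ z : ℂ, z.re ≤ 1 / 2 → ‖b z‖ ≤ C)
    (hbL : MemLp (fun s : ℝ => b (linePoint (1 / 2) s)) ∞ volume) :
    offDiagonal (hbL.toLp _) = 0 := by
  ext1 f
  have := offDiagonal_apply_mem (u := hbL.toLp _) (V := ⊥) isClosed_singleton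
    (fun f hf => (Submodule.mem_bot ℂ).2 (offDiagonal_apply_eq_zero hf
      (multiplication_mem_hardySpace hb hbC hbL hf))) f
  simpa using this

/-- The off-diagonal part of a simple pole has rank at most one. -/
theorem rank_offDiagonal_inv_sub_le_one {a : ℂ} (ha : a.re < 1 / 2)
    (hL : MemLp (fun s : ℝ => (linePoint (1 / 2) s - a)⁻¹) ∞ volume) :
    LinearMap.rank (offDiagonal (hL.toLp _) : BoundaryL2 →ₗ[ℂ] BoundaryL2) ≤ 1 := by
  obtain ⟨v, hv⟩ : ∃ v : BoundaryL2, ∀ f ∈ hardySpace, offDiagonal (hL.toLp _) f ∈ ℂ ∙ v := by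
    -- Evaluation at `a` is the only obstruction to dividing by `z - a`. If some `e` has an
    -- extension not vanishing at `a`, every other `f` can be corrected by a multiple of `e`, so the
    -- image of `e` spans.
    by_cases hall : ∀ f ∈ hardySpace, ∀ G, IsHardyExtension G f → G a = 0
    · refine ⟨0, fun f hf => ?_⟩
      obtain ⟨G, hG⟩ := id hf
      rw [offDiagonal_apply_eq_zero hf
        (multiplication_inv_sub_mem_hardySpace ha hL hG (hall f hf G hG))]
      exact Submodule.zero_mem _
    · push Not at hall
      obtain ⟨e, he, E, hE, hEa⟩ := hall
      refine ⟨offDiagonal (hL.toLp _) e, fun f hf => ?_⟩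
      obtain ⟨G, hG⟩ := id hf
      set c : ℂ := -(G a / E a)
      have h1 : IsHardyExtension (G + c • E) (f + c • e : BoundaryL2) := by
        refine (hG.add (Lp.aestronglyMeasurable f)
          ((Lp.aestronglyMeasurable e).const_smul c) (hE.smul c)).congr ?_
        filter_upwards [Lp.coeFn_add f (c • e), Lp.coeFn_smul c e] with s h2 h3
        rw [h2, Pi.add_apply, Pi.add_apply, h3]
      have h2 := offDiagonal_apply_eq_zero (u := hL.toLp _) ⟨_, h1⟩
        (multiplication_inv_sub_mem_hardySpace ha hL h1 (by
          simp only [Pi.add_apply, Pi.smul_apply, smul_eq_mul, c]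
          field_simp
          ring))
      rw [map_add, map_smul] at h2
      rw [eq_neg_of_add_eq_zero_left h2]
      exact Submodule.neg_mem _ (Submodule.smul_mem _ _ (Submodule.mem_span_singleton_self _))
  have hle : LinearMap.range (offDiagonal (hL.toLp _) : BoundaryL2 →ₗ[ℂ] BoundaryL2) ≤ ℂ ∙ v := by
    rintro _ ⟨f, rfl⟩
    exact offDiagonal_apply_mem (Submodule.closed_of_finiteDimensional _) hv f
  exact (Submodule.rank_mono hle).trans ((rank_span_le _).trans (by simp))

/-- A holomorphic factor of the symbol can be moved out to the right. -/
theorem offDiagonal_mul_holomorphic {a : ℝ → ℂ} (ha : MemLp a ∞ volume) {b : ℂ → ℂ} {C : ℝ}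
    (hb : DifferentiableOn ℂ b {z : ℂ | z.re < 1})
    (hbC : ∀ z : ℂ, z.re ≤ 1 / 2 → ‖b z‖ ≤ C)
    (hbL : MemLp (fun s : ℝ => b (linePoint (1 / 2) s)) ∞ volume)
    (hab : MemLp (fun s : ℝ => a s * b (linePoint (1 / 2) s)) ∞ volume) :
    offDiagonal (hab.toLp _) =
      offDiagonal (ha.toLp _) ∘L multiplication (hbL.toLp _) ∘L hardyProjection := by
  have hmul : ∀ f, multiplication (hab.toLp _) f =
      multiplication (ha.toLp _) (multiplication (hbL.toLp _) f) := fun f => by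
    refine Lp.ext ?_
    filter_upwards [multiplication_toLp_coeFn hab f, multiplication_toLp_coeFn hbL f,
      multiplication_toLp_coeFn ha (multiplication (hbL.toLp _) f)] with s h1 h2 h3
    rw [h1, h3, h2, mul_assoc]
  ext1 f
  -- Multiplication by `b` preserves the closed Hardy space, so the projection inside `offDiagonal
  -- (ha.toLp a)` acts as the identity here.
  have hmem : multiplication (hbL.toLp _) (hardyProjection f) ∈ hardySpace.topologicalClosure :=
    hardySpace_closure_induction hardySpace.isClosed_topologicalClosure (fun g hg =>
      hardySpace.le_topologicalClosure (multiplication_mem_hardySpace hb hbC hbL hg))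
      (hardyProjection_mem f)
  simp only [offDiagonal, ContinuousLinearMap.comp_apply]
  rw [hmul, hardyProjection_apply_of_mem hmem]

theorem memLp_top_line {b : ℂ → ℂ} {C : ℝ} (hb : Continuous fun s => b (linePoint (1 / 2) s))
    (hbC : ∀ z : ℂ, z.re = 1 / 2 → ‖b z‖ ≤ C) :
    MemLp (fun s : ℝ => b (linePoint (1 / 2) s)) ∞ volume :=
  memLp_top_of_bound hb.aestronglyMeasurable C
    (Eventually.of_forall fun _ => hbC _ (re_linePoint _ _))

theorem memLp_top_inv_sub {a : ℂ} (ha : a.re < 1 / 2) :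
    MemLp (fun s : ℝ => (linePoint (1 / 2) s - a)⁻¹) ∞ volume := by
  have hle : ∀ z : ℂ, z.re = 1 / 2 → 1 / 2 - a.re ≤ ‖z - a‖ := fun z hz => by
    have := (le_abs_self _).trans (Complex.abs_re_le_norm (z - a))
    rwa [Complex.sub_re, hz] at this
  refine memLp_top_line (b := fun z => (z - a)⁻¹) (C := (1 / 2 - a.re)⁻¹) ?_ fun z hz => ?_
  · refine ((continuous_linePoint _).sub continuous_const).inv₀ fun _ => ?_
    exact norm_pos_iff.1 ((sub_pos.2 ha).trans_le (hle _ (re_linePoint _ _)))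
  · rw [norm_inv]
    have := sub_pos.2 ha
    gcongr
    exact hle z hz

theorem norm_toLp_top_le {a : ℝ → ℂ} (ha : MemLp a ∞ volume) {ε : ℝ} (hε : 0 ≤ ε)
    (h : ∀ s, ‖a s‖ ≤ ε) : ‖ha.toLp a‖ ≤ ε := by
  rw [Lp.norm_toLp]
  refine ENNReal.toReal_le_of_le_ofReal hε ?_
  rw [eLpNorm_exponent_top]
  exact eLpNormEssSup_le_of_ae_bound (Eventually.of_forall h)

theorem rank_sum_smul_le {H : Type*} [NormedAddCommGroup H] [InnerProductSpace ℂ H]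
    (A : ℕ → H →L[ℂ] H) (c : ℕ → ℂ)
    (hA : ∀ n, LinearMap.rank (A n : H →ₗ[ℂ] H) ≤ 1) (k : ℕ) :
    LinearMap.rank ((∑ n ∈ Finset.range k, c n • A n : H →L[ℂ] H) : H →ₗ[ℂ] H) ≤ k := by
  induction k with
  | zero => simp
  | succ k ih =>
    rw [Finset.sum_range_succ, ContinuousLinearMap.toLinearMap_add]
    refine (LinearMap.rank_add_le _ _).trans ?_
    rw [Nat.cast_succ]
    refine add_le_add ih ((Submodule.rank_mono ?_).trans (hA k))
    rintro _ ⟨x, rfl⟩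
    exact ⟨c k • x, by simp⟩

/-- A symbol that is, up to an error `ε`, the sum of `k` simple poles in the half-plane and of a
bounded holomorphic function has an off-diagonal part of rank at most `k` up to an error `ε`. -/
theorem exists_rank_le_norm_offDiagonal_sub_le {a : ℝ → ℂ} (ha : MemLp a ∞ volume) {k : ℕ}
    {c : ℕ → ℂ} {b : ℂ → ℂ} {C ε : ℝ} (hb : DifferentiableOn ℂ b {z : ℂ | z.re < 1})
    (hbC : ∀ z : ℂ, z.re ≤ 1 / 2 → ‖b z‖ ≤ C)
    (h : ∀ s, ‖a s - ∑ n ∈ Finset.range k, c n * (linePoint (1 / 2) s - (-(n : ℂ)))⁻¹ -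
      b (linePoint (1 / 2) s)‖ ≤ ε) :
    ∃ R : BoundaryL2 →L[ℂ] BoundaryL2, LinearMap.rank (R : BoundaryL2 →ₗ[ℂ] BoundaryL2) ≤ k ∧
      ‖offDiagonal (ha.toLp a) - R‖ ≤ ε := by
  have hre : ∀ n : ℕ, (-(n : ℂ)).re < 1 / 2 := fun n => by
    have : (0 : ℝ) ≤ n := n.cast_nonneg
    simp only [Complex.neg_re, Complex.natCast_re]
    linarith
  have hpole := fun n : ℕ => memLp_top_inv_sub (hre n)
  have hbL : MemLp (fun s : ℝ => b (linePoint (1 / 2) s)) ∞ volume := by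
    refine memLp_top_line ?_ fun z hz => hbC z hz.le
    exact hb.continuousOn.comp_continuous (continuous_linePoint _) fun s => by
      simp only [Set.mem_ofPred_eq, re_linePoint]; norm_num
  refine ⟨∑ n ∈ Finset.range k, c n • offDiagonal ((hpole n).toLp _),
    rank_sum_smul_le _ c (fun n => rank_offDiagonal_inv_sub_le_one (hre n) (hpole n)) k, ?_⟩
  have hε : 0 ≤ ε := (norm_nonneg _).trans (h 0)
  have hdiff := (ha.sub (memLp_finsetSum (Finset.range k)
    fun n _ => (hpole n).const_mul (c n))).sub hbL
  have hsum : offDiagonal (ha.toLp a) = offDiagonal (hdiff.toLp _) +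
      ∑ n ∈ Finset.range k, c n • offDiagonal ((hpole n).toLp _) + offDiagonal (hbL.toLp _) := by
    have h1 : ∑ n ∈ Finset.range k, c n • offDiagonal ((hpole n).toLp _) =
        offDiagonal (∑ n ∈ Finset.range k, c n • (hpole n).toLp _) := by
      let A : BoundaryLinfty →+ (BoundaryL2 →L[ℂ] BoundaryL2) :=
        AddMonoidHom.mk' offDiagonal offDiagonal_add
      have := map_sum A (fun n => c n • (hpole n).toLp _) (Finset.range k)
      simp only [A, AddMonoidHom.mk'_apply, offDiagonal_smul] at this
      exact this.symm
    rw [h1, ← offDiagonal_add, ← offDiagonal_add]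
    congr 1
    have h2 : ∀ k : ℕ, ∀ᵐ s, (∑ n ∈ Finset.range k, c n • (hpole n).toLp _ : BoundaryLinfty) s =
        ∑ n ∈ Finset.range k, c n * (linePoint (1 / 2) s - (-(n : ℂ)))⁻¹ := fun k => by
      induction k with
      | zero => simp
      | succ k ih =>
        rw [Finset.sum_range_succ]
        filter_upwards [ih, Lp.coeFn_add (∑ n ∈ Finset.range k, c n • (hpole n).toLp _)
          (c k • (hpole k).toLp _), Lp.coeFn_smul (c k) ((hpole k).toLp _),
          (hpole k).coeFn_toLp] with s h1 h2 h3 h4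
        rw [h2, Pi.add_apply, h1, h3, Pi.smul_apply, h4, Finset.sum_range_succ, smul_eq_mul]
    refine Lp.ext ?_
    filter_upwards [ha.coeFn_toLp, hdiff.coeFn_toLp, hbL.coeFn_toLp, h2 k,
      Lp.coeFn_add (hdiff.toLp _ + ∑ n ∈ Finset.range k, c n • (hpole n).toLp _) (hbL.toLp _),
      Lp.coeFn_add (hdiff.toLp _) (∑ n ∈ Finset.range k, c n • (hpole n).toLp _)]
      with s h1 h2 h3 h4 h5 h6
    rw [h5, Pi.add_apply, h6, Pi.add_apply, h1, h2, h3, h4]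
    simp only [Pi.sub_apply]
    ring
  rw [hsum, offDiagonal_eq_zero_of_holomorphic hb hbC hbL, add_zero, add_sub_cancel_right]
  refine (norm_offDiagonal_le _).trans (norm_toLp_top_le _ hε fun s => ?_)
  simpa using h s

end QuasiInner

namespace QuasiInner

/-! ### The Mellin transform of an exponential -/

theorem norm_cexp_neg_mul_ofReal (a : ℂ) (x : ℝ) :
    ‖Complex.exp (-(a * x))‖ = Real.exp (-(a.re * x)) := by
  simp [Complex.norm_exp]

theorem norm_ofReal_cpow {x : ℝ} (hx : 0 < x) (z : ℂ) : ‖(x : ℂ) ^ z‖ = x ^ z.re :=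
  Complex.norm_cpow_eq_rpow_re_of_pos hx z

theorem continuousOn_ofReal_cpow (z : ℂ) :
    ContinuousOn (fun x : ℝ => (x : ℂ) ^ z) (Set.Ioi 0) := fun x hx =>
  (Complex.continuousAt_ofReal_cpow_const x z (Or.inr (ne_of_gt hx))).continuousWithinAt

theorem aestronglyMeasurable_cpow_mul_exp (z a : ℂ) {S : Set ℝ} (hS : MeasurableSet S)
    (hS0 : S ⊆ Set.Ioi 0) :
    AEStronglyMeasurable (fun x : ℝ => (x : ℂ) ^ z * Complex.exp (-(a * x)))
      (volume.restrict S) :=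
  (((continuousOn_ofReal_cpow z).mono hS0).mul (by fun_prop)).aestronglyMeasurable hS

theorem integrableOn_cpow_mul_exp {z a : ℂ} (hz : 0 < z.re) (ha : 0 < a.re) :
    IntegrableOn (fun x : ℝ => (x : ℂ) ^ (z - 1) * Complex.exp (-(a * x))) (Set.Ioi 0) := by
  have h := integrableOn_rpow_mul_exp_neg_mul_rpow (s := z.re - 1) (p := 1) (by linarith)
    one_pos ha
  refine Integrable.mono' h (aestronglyMeasurable_cpow_mul_exp _ _ measurableSet_Ioi subset_rfl) ?_
  filter_upwards [ae_restrict_mem measurableSet_Ioi] with x hx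
  rw [norm_mul, norm_ofReal_cpow hx, norm_cexp_neg_mul_ofReal]
  simp

theorem differentiableAt_integral_cpow_mul_exp {z a : ℂ} (hz : 0 < z.re) (ha : 0 < a.re) :
    DifferentiableAt ℂ
      (fun a : ℂ => ∫ x : ℝ in Set.Ioi 0, (x : ℂ) ^ (z - 1) * Complex.exp (-(a * x))) a := by
  have hδ : 0 < a.re / 2 := by linarith
  have hbd := integrableOn_rpow_mul_exp_neg_mul_rpow (s := z.re) (p := 1) (by linarith) one_pos hδ
  refine (hasDerivAt_integral_of_dominated_loc_of_deriv_le (s := Metric.ball a (a.re / 2))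
    (F := fun (a : ℂ) (x : ℝ) => (x : ℂ) ^ (z - 1) * Complex.exp (-(a * x)))
    (F' := fun (a : ℂ) (x : ℝ) => (x : ℂ) ^ (z - 1) * (Complex.exp (-(a * x)) * (-(x : ℂ))))
    (Metric.ball_mem_nhds a hδ)
    (Eventually.of_forall fun a => aestronglyMeasurable_cpow_mul_exp _ _ measurableSet_Ioi
      subset_rfl) (integrableOn_cpow_mul_exp hz ha) ?_ ?_ hbd ?_).2.differentiableAt
  · exact ((continuousOn_ofReal_cpow _).mul (by fun_prop)).aestronglyMeasurable measurableSet_Ioi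
  · filter_upwards [ae_restrict_mem measurableSet_Ioi] with x hx w hw
    have hx' : (0 : ℝ) < x := hx
    have hre : a.re / 2 ≤ w.re := by
      rw [Metric.mem_ball, dist_eq_norm] at hw
      have := abs_lt.1 ((Complex.abs_re_le_norm (w - a)).trans_lt hw)
      rw [Complex.sub_re] at this
      linarith [this.1]
    rw [norm_mul, norm_mul, norm_ofReal_cpow hx', norm_cexp_neg_mul_ofReal, norm_neg,
      Complex.norm_real, Real.norm_of_nonneg hx'.le, mul_comm (Real.exp _), ← mul_assoc,
      Complex.sub_re, Complex.one_re]
    nth_rewrite 2 [← Real.rpow_one x]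
    rw [← Real.rpow_add hx', Real.rpow_one, sub_add_cancel, neg_mul]
    gcongr
  · refine Eventually.of_forall fun x w _ => ?_
    have h1 : HasDerivAt (fun w : ℂ => -(w * x)) (-(x : ℂ)) w := by
      simpa [Pi.neg_def] using ((hasDerivAt_id w).mul_const (x : ℂ)).neg
    exact h1.cexp.const_mul _

/-- Both sides are holomorphic in `a` on `Re a > 0` and agree on the positive reals, which
accumulate at `1`; the identity theorem does the rest. -/
theorem integral_cpow_mul_exp_eq_Gamma {z a : ℂ} (hz : 0 < z.re) (ha : 0 < a.re) :
    ∫ x : ℝ in Set.Ioi 0, (x : ℂ) ^ (z - 1) * Complex.exp (-(a * x)) =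
      Complex.Gamma z * a ^ (-z) := by
  have hopen : IsOpen {a : ℂ | 0 < a.re} := isOpen_lt continuous_const Complex.continuous_re
  have hconn : IsPreconnected {a : ℂ | 0 < a.re} := (convex_halfSpace_re_gt 0).isPreconnected
  refine AnalyticOnNhd.eqOn_of_preconnected_of_frequently_eq
    (f := fun a : ℂ => ∫ x : ℝ in Set.Ioi 0, (x : ℂ) ^ (z - 1) * Complex.exp (-(a * x)))
    (g := fun a : ℂ => Complex.Gamma z * a ^ (-z)) (z₀ := 1)
    (DifferentiableOn.analyticOnNhd (fun a ha =>
      (differentiableAt_integral_cpow_mul_exp hz ha).differentiableWithinAt) hopen)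
    (DifferentiableOn.analyticOnNhd (fun a ha => ?_) hopen) hconn
    (show (0 : ℝ) < (1 : ℂ).re by simp) ?_ ha
  · have : a ∈ Complex.slitPlane := Or.inl ha
    exact ((differentiableAt_id.cpow_const this).const_mul _).differentiableWithinAt
  · have h1 : Tendsto (fun r : ℝ => (r : ℂ)) (𝓝[≠] 1) (𝓝[≠] 1) := by
      refine tendsto_nhdsWithin_iff.2 ⟨(Complex.continuous_ofReal.tendsto' 1 1 (by simp)).mono_left
        nhdsWithin_le_nhds, ?_⟩
      filter_upwards [self_mem_nhdsWithin] with r hr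
      simpa using hr
    refine h1.frequently (Eventually.frequently ?_)
    filter_upwards [nhdsWithin_le_nhds (Ioi_mem_nhds (zero_lt_one' ℝ))] with r hr
    have hr' : (0 : ℝ) < r := hr
    have := Complex.integral_cpow_mul_exp_neg_mul_Ioi hz hr'
    rw [this, mul_comm, one_div, Complex.cpow_neg, Complex.inv_cpow]
    rw [Complex.arg_ofReal_of_nonneg hr'.le]
    exact Real.pi_pos.ne

/-- The integral of `x ^ (z - 1) * exp (-a x)` over `(1, ∞)`, after one integration by parts. It
makes sense for `0 ≤ Re a`, `a ≠ 0`. -/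
noncomputable def upperMellin (a z : ℂ) : ℂ :=
  Complex.exp (-a) / a +
    (z - 1) / a * ∫ x : ℝ in Set.Ioi 1, (x : ℂ) ^ (z - 2) * Complex.exp (-(a * x))

theorem Ioi_one_subset : Set.Ioi (1 : ℝ) ⊆ Set.Ioi 0 := Set.Ioi_subset_Ioi zero_le_one

theorem norm_cexp_neg_mul_le_one {a : ℂ} (ha : 0 ≤ a.re) {x : ℝ} (hx : 0 < x) :
    ‖Complex.exp (-(a * x))‖ ≤ 1 := by
  rw [norm_cexp_neg_mul_ofReal, Real.exp_le_one_iff]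
  have := mul_nonneg ha hx.le
  linarith

theorem norm_cpow_mul_exp_le {a : ℂ} (ha : 0 ≤ a.re) (z : ℂ) {x : ℝ} (hx : 0 < x) :
    ‖(x : ℂ) ^ z * Complex.exp (-(a * x))‖ ≤ x ^ z.re := by
  rw [norm_mul, norm_ofReal_cpow hx]
  exact mul_le_of_le_one_right (Real.rpow_nonneg hx.le _) (norm_cexp_neg_mul_le_one ha hx)

theorem integrableOn_rpow_Ioi_one {z : ℂ} (hz : z.re < 1) :
    IntegrableOn (fun x : ℝ => x ^ (z - 2).re) (Set.Ioi 1) :=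
  integrableOn_Ioi_rpow_of_lt (by simp; linarith) one_pos

theorem integrableOn_cpow_mul_exp_Ioi_one {a z : ℂ} (ha : 0 ≤ a.re) (hz : z.re < 1) :
    IntegrableOn (fun x : ℝ => (x : ℂ) ^ (z - 2) * Complex.exp (-(a * x))) (Set.Ioi 1) := by
  refine Integrable.mono' (integrableOn_rpow_Ioi_one hz)
    (aestronglyMeasurable_cpow_mul_exp _ _ measurableSet_Ioi Ioi_one_subset) ?_
  filter_upwards [ae_restrict_mem measurableSet_Ioi] with x hx
  exact norm_cpow_mul_exp_le ha _ (Ioi_one_subset hx)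

theorem integrableOn_rpow_Ioc {z : ℂ} (hz : 0 < z.re) :
    IntegrableOn (fun x : ℝ => x ^ (z - 1).re) (Set.Ioc 0 1) :=
  (intervalIntegrable_iff_integrableOn_Ioc_of_le zero_le_one).1
    (intervalIntegral.intervalIntegrable_rpow' (by simpa using hz))

theorem integrableOn_cpow_mul_exp_Ioc {a z : ℂ} (ha : 0 ≤ a.re) (hz : 0 < z.re) :
    IntegrableOn (fun x : ℝ => (x : ℂ) ^ (z - 1) * Complex.exp (-(a * x))) (Set.Ioc 0 1) := by
  refine Integrable.mono' (integrableOn_rpow_Ioc hz)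
    (aestronglyMeasurable_cpow_mul_exp _ _ measurableSet_Ioc Set.Ioc_subset_Ioi_self) ?_
  filter_upwards [ae_restrict_mem measurableSet_Ioc] with x hx
  exact norm_cpow_mul_exp_le ha _ hx.1

theorem integral_Ioi_one_eq_upperMellin {a z : ℂ} (ha : 0 < a.re) (hz : 0 < z.re)
    (hz1 : z.re < 1) :
    ∫ x : ℝ in Set.Ioi 1, (x : ℂ) ^ (z - 1) * Complex.exp (-(a * x)) = upperMellin a z := by
  have ha0 : a ≠ 0 := by rintro rfl; simp at ha
  have hu : ∀ x ∈ Set.Ioi (1 : ℝ), HasDerivAt (fun x : ℝ => (x : ℂ) ^ (z - 1))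
      ((z - 1) * (x : ℂ) ^ (z - 2)) x := fun x hx => by
    have hx0 : (x : ℝ) ≠ 0 := (Ioi_one_subset hx).ne'
    have h1 : z - 1 ≠ 0 := fun h => by
      rw [sub_eq_zero] at h
      rw [h, Complex.one_re] at hz1
      exact lt_irrefl _ hz1
    have := hasDerivAt_ofReal_cpow_const hx0 h1
    rwa [show z - 1 - 1 = z - 2 by ring] at this
  have hv : ∀ x : ℝ, HasDerivAt (fun x : ℝ => -(Complex.exp (-(a * x)) / a))
      (Complex.exp (-(a * x))) x := fun x => by
    have h1 : HasDerivAt (fun x : ℝ => -(a * (x : ℂ))) (-a) x := by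
      simpa [Pi.neg_def] using ((Complex.ofRealCLM.hasDerivAt (x := x)).const_mul a).neg
    convert! (h1.cexp.div_const a).neg using 1
    field_simp
  have hint := (integrableOn_cpow_mul_exp hz ha).mono_set Ioi_one_subset
  have hint2 : IntegrableOn (fun x : ℝ => -((z - 1) / a) *
      ((x : ℂ) ^ (z - 2) * Complex.exp (-(a * x)))) (Set.Ioi 1) :=
    (integrableOn_cpow_mul_exp_Ioi_one ha.le hz1).const_mul (-((z - 1) / a))
  have key := integral_Ioi_mul_deriv_eq_deriv_mul (a := (1 : ℝ))
    (u := fun x : ℝ => (x : ℂ) ^ (z - 1)) (u' := fun x : ℝ => (z - 1) * (x : ℂ) ^ (z - 2))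
    (v := fun x : ℝ => -(Complex.exp (-(a * x)) / a)) (v' := fun x : ℝ => Complex.exp (-(a * x)))
    (a' := -(Complex.exp (-a) / a)) (b' := 0) hu (fun x _ => hv x) hint
    (hint2.congr_fun (fun x _ => by simp only [Pi.mul_apply]; ring) measurableSet_Ioi) ?_ ?_
  · rw [key, upperMellin, ← integral_const_mul, zero_sub, neg_neg, sub_eq_add_neg,
      ← integral_neg]
    congr 1
    refine integral_congr_ae (Eventually.of_forall fun x => ?_)
    simp only
    ring
  · have hc : ContinuousAt ((fun x : ℝ => (x : ℂ) ^ (z - 1)) *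
        fun x : ℝ => -(Complex.exp (-(a * x)) / a)) 1 :=
      (Complex.continuousAt_ofReal_cpow_const 1 _ (Or.inr one_ne_zero)).mul (hv 1).continuousAt
    have := hc.tendsto.mono_left (nhdsWithin_le_nhds (s := Set.Ioi 1))
    simpa using this
  · have hexp : Tendsto (fun x : ℝ => Real.exp (-(a.re * x)) * ‖a‖⁻¹) atTop (𝓝 0) := by
      have h1 : Tendsto (fun x : ℝ => -(a.re * x)) atTop atBot :=
        tendsto_neg_atTop_atBot.comp (tendsto_id.const_mul_atTop ha)
      simpa using (Real.tendsto_exp_atBot.comp h1).mul_const ‖a‖⁻¹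
    refine squeeze_zero_norm' ?_ hexp
    filter_upwards [eventually_ge_atTop 1] with x hx
    rw [Pi.mul_apply, norm_mul, norm_neg, norm_div, norm_cexp_neg_mul_ofReal, div_eq_mul_inv,
      norm_ofReal_cpow (by linarith)]
    refine mul_le_of_le_one_left (by positivity) (Real.rpow_le_one_of_one_le_of_nonpos hx ?_)
    simp only [Complex.sub_re, Complex.one_re]
    linarith

theorem Gamma_mul_cpow_eq_of_re_pos {a z : ℂ} (ha : 0 < a.re) (hz : 0 < z.re) (hz1 : z.re < 1) :
    Complex.Gamma z * a ^ (-z) =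
      (∫ x : ℝ in Set.Ioc 0 1, (x : ℂ) ^ (z - 1) * Complex.exp (-(a * x))) + upperMellin a z := by
  rw [← integral_cpow_mul_exp_eq_Gamma hz ha, ← integral_Ioi_one_eq_upperMellin ha hz hz1,
    ← Set.Ioc_union_Ioi_eq_Ioi (zero_le_one' ℝ)]
  exact setIntegral_union (Set.Ioc_disjoint_Ioi le_rfl) measurableSet_Ioi
    (integrableOn_cpow_mul_exp_Ioc ha.le hz)
    ((integrableOn_cpow_mul_exp hz ha).mono_set Ioi_one_subset)

/-- Allows approaching a purely imaginary `a` from the right: `|exp (-(a + ε) x)| ≤ 1` leaves `x ^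
Re z` as dominating function. -/
theorem tendsto_integral_cpow_mul_exp {a z : ℂ} (ha : a.re = 0) {S : Set ℝ}
    (hS : MeasurableSet S) (hS0 : S ⊆ Set.Ioi 0)
    (hint : IntegrableOn (fun x : ℝ => x ^ z.re) S) :
    Tendsto (fun ε : ℝ => ∫ x : ℝ in S, (x : ℂ) ^ z * Complex.exp (-((a + ε) * x)))
      (𝓝[>] 0) (𝓝 (∫ x : ℝ in S, (x : ℂ) ^ z * Complex.exp (-(a * x)))) := by
  refine tendsto_integral_filter_of_dominated_convergence (fun x => x ^ z.re)
    (Eventually.of_forall fun ε => aestronglyMeasurable_cpow_mul_exp _ _ hS hS0) ?_ hint ?_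
  · filter_upwards [self_mem_nhdsWithin] with ε hε
    filter_upwards [ae_restrict_mem hS] with x hx
    refine norm_cpow_mul_exp_le ?_ _ (hS0 hx)
    simpa [ha] using (le_of_lt hε)
  · refine Eventually.of_forall fun x => Tendsto.mono_left ?_ nhdsWithin_le_nhds
    exact Continuous.tendsto' (by fun_prop) _ _ (by simp)

/-- The Mellin transform of an oscillating exponential, split at `1`. -/
theorem Gamma_mul_cpow_eq {a z : ℂ} (ha : a.re = 0) (ha0 : a ≠ 0) (hz : 0 < z.re)
    (hz1 : z.re < 1) :
    Complex.Gamma z * a ^ (-z) =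
      (∫ x : ℝ in Set.Ioc 0 1, (x : ℂ) ^ (z - 1) * Complex.exp (-(a * x))) + upperMellin a z := by
  have hbase : Tendsto (fun ε : ℝ => a + ε) (𝓝[>] 0) (𝓝 a) :=
    Tendsto.mono_left (Continuous.tendsto' (by fun_prop) _ _ (by simp)) nhdsWithin_le_nhds
  -- A nonzero imaginary number avoids the cut of the principal power, so `a ^ (-z)` is continuous
  -- there.
  have hslit : a ∈ Complex.slitPlane := by
    refine Or.inr fun h => ha0 (Complex.ext ha h)
  have hleft : Tendsto (fun ε : ℝ => Complex.Gamma z * (a + ε) ^ (-z)) (𝓝[>] 0)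
      (𝓝 (Complex.Gamma z * a ^ (-z))) :=
    (((continuousAt_cpow_const hslit).tendsto).comp hbase).const_mul _
  have hright := (tendsto_integral_cpow_mul_exp (z := z - 1) ha measurableSet_Ioc
    Set.Ioc_subset_Ioi_self (integrableOn_rpow_Ioc hz)).add
    (((((Complex.continuous_exp.tendsto _).comp hbase.neg).div hbase ha0)).add
      (((tendsto_const_nhds (x := z - 1)).div hbase ha0).mul
        (tendsto_integral_cpow_mul_exp (z := z - 2) ha measurableSet_Ioi
          Ioi_one_subset (integrableOn_rpow_Ioi_one hz1))))
  refine tendsto_nhds_unique_of_eventuallyEq hleft hright ?_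
  filter_upwards [self_mem_nhdsWithin] with ε hε
  exact Gamma_mul_cpow_eq_of_re_pos (by simpa [ha] using hε) hz hz1

theorem norm_upperMellin_le {a z : ℂ} (ha : a.re = 0) (hz1 : z.re < 1) :
    ‖upperMellin a z‖ ≤ ‖a‖⁻¹ * (1 + ‖z - 1‖ / (1 - z.re)) := by
  have hint : ‖∫ x : ℝ in Set.Ioi 1, (x : ℂ) ^ (z - 2) * Complex.exp (-(a * x))‖ ≤
      (1 - z.re)⁻¹ := by
    have h1 : ∫ x : ℝ in Set.Ioi 1, x ^ (z - 2).re = (1 - z.re)⁻¹ := by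
      rw [integral_Ioi_rpow_of_lt (by simp; linarith) one_pos, Real.one_rpow]
      simp only [Complex.sub_re, Complex.re_ofNat]
      rw [neg_div, one_div, ← inv_neg]
      congr 1
      ring
    rw [← h1]
    refine norm_integral_le_of_norm_le (integrableOn_rpow_Ioi_one hz1) ?_
    filter_upwards [ae_restrict_mem measurableSet_Ioi] with x hx
    exact norm_cpow_mul_exp_le ha.ge _ (Ioi_one_subset hx)
  have hexp : ‖Complex.exp (-a)‖ = 1 := by
    rw [Complex.norm_exp, Complex.neg_re, ha, neg_zero, Real.exp_zero]
  calc ‖upperMellin a z‖ ≤ ‖Complex.exp (-a) / a‖ + ‖(z - 1) / a‖ *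
        ‖∫ x : ℝ in Set.Ioi 1, (x : ℂ) ^ (z - 2) * Complex.exp (-(a * x))‖ :=
        (norm_add_le _ _).trans (by rw [norm_mul])
    _ ≤ ‖Complex.exp (-a) / a‖ + ‖(z - 1) / a‖ * (1 - z.re)⁻¹ := by gcongr
    _ = ‖a‖⁻¹ * (1 + ‖z - 1‖ / (1 - z.re)) := by
        rw [norm_div, norm_div, hexp]
        ring

/-- The remaining integral is the Mellin transform at `z - 1` of the exponential cut off below `1`.
This function is bounded at infinity and vanishes near `0`, which makes its transform holomorphic
for `Re (z - 1) < 0`. -/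
theorem differentiableOn_upperMellin {a : ℂ} (ha : a.re = 0) :
    DifferentiableOn ℂ (upperMellin a) {z : ℂ | z.re < 1} := by
  set f : ℝ → ℂ := (Set.Ioi 1).indicator fun x : ℝ => Complex.exp (-(a * x)) with hf
  have hmellin : ∀ z : ℂ, ∫ x : ℝ in Set.Ioi 1, (x : ℂ) ^ (z - 2) * Complex.exp (-(a * x)) =
      mellin f (z - 1) := fun z => by
    have h1 : ∀ x : ℝ, (x : ℂ) ^ (z - 1 - 1) • f x =
        (Set.Ioi 1).indicator (fun x : ℝ => (x : ℂ) ^ (z - 2) * Complex.exp (-(a * x))) x := by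
      intro x
      by_cases hx : x ∈ Set.Ioi (1 : ℝ)
      · rw [hf, Set.indicator_of_mem hx, Set.indicator_of_mem hx, smul_eq_mul,
          show z - 1 - 1 = z - 2 by ring]
      · rw [hf, Set.indicator_of_notMem hx, Set.indicator_of_notMem hx, smul_zero]
    rw [mellin]
    simp_rw [h1]
    rw [setIntegral_indicator measurableSet_Ioi, Set.inter_eq_right.2 Ioi_one_subset]
  have hloc : LocallyIntegrableOn f (Set.Ioi 0) :=
    ((Continuous.locallyIntegrable (by fun_prop)).indicator
      measurableSet_Ioi).locallyIntegrableOn _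
  have htop : f =O[atTop] fun x : ℝ => x ^ (-(0 : ℝ)) := by
    refine Asymptotics.IsBigO.of_bound 1 ?_
    filter_upwards [eventually_gt_atTop 1] with x hx
    rw [hf, Set.indicator_of_mem (Set.mem_Ioi.2 hx)]
    simpa using norm_cexp_neg_mul_le_one ha.ge (x := x) (by linarith)
  intro z hz
  have hz1 : z.re < 1 := hz
  have hbot : f =O[𝓝[>] 0] fun x : ℝ => x ^ (-(z.re - 2)) := by
    refine Asymptotics.IsBigO.of_bound 1 ?_
    filter_upwards [nhdsWithin_le_nhds (Iio_mem_nhds (zero_lt_one' ℝ))] with x hx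
    rw [hf, Set.indicator_of_notMem (by simpa using (le_of_lt hx)), norm_zero]
    positivity
  have hd := mellin_differentiableAt_of_isBigO_rpow (s := z - 1) hloc htop
    (by simpa using hz1) hbot (by simp)
  have hd2 : DifferentiableAt ℂ (fun z : ℂ => mellin f (z - 1)) z :=
    DifferentiableAt.comp (f := fun z : ℂ => z - 1) z hd (by fun_prop)
  refine DifferentiableAt.differentiableWithinAt ?_
  unfold upperMellin
  simp_rw [hmellin]
  fun_prop

/-! ### Poles from the integral over `(0, 1]` -/

theorem integral_rpow_neg_half : ∫ x : ℝ in Set.Ioc 0 1, x ^ (-(1 / 2) : ℝ) = 2 := by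
  rw [← intervalIntegral.integral_of_le zero_le_one, integral_rpow (Or.inl (by norm_num))]
  norm_num

theorem integrableOn_rpow_neg_half :
    IntegrableOn (fun x : ℝ => x ^ (-(1 / 2) : ℝ)) (Set.Ioc 0 1) :=
  (intervalIntegrable_iff_integrableOn_Ioc_of_le zero_le_one).1
    (intervalIntegral.intervalIntegrable_rpow' (by norm_num))

theorem norm_integral_cpow_mul_le {z : ℂ} (hz : z.re = 1 / 2) {g : ℝ → ℂ} {D : ℝ}
    (hg : ∀ x ∈ Set.Ioc (0 : ℝ) 1, ‖g x‖ ≤ D) :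
    ‖∫ x : ℝ in Set.Ioc 0 1, (x : ℂ) ^ (z - 1) * g x‖ ≤ 2 * D := by
  rw [← integral_rpow_neg_half, ← integral_mul_const]
  refine norm_integral_le_of_norm_le (integrableOn_rpow_neg_half.mul_const D) ?_
  filter_upwards [ae_restrict_mem measurableSet_Ioc] with x hx
  rw [norm_mul, norm_ofReal_cpow hx.1, Complex.sub_re, hz, Complex.one_re,
    show (1 / 2 - 1 : ℝ) = -(1 / 2) by norm_num]
  exact mul_le_mul_of_nonneg_left (hg x hx) (Real.rpow_nonneg hx.1.le _)

/-- The integral over `(0, 1]` is, up to a small error, a sum of simple poles. -/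
theorem norm_integral_cpow_mul_exp_sub_sum_le {a z : ℂ} (ha : a.re = 0) (hz : z.re = 1 / 2)
    {k : ℕ} (hk : ‖a‖ / k.succ ≤ 1 / 2) :
    ‖(∫ x : ℝ in Set.Ioc 0 1, (x : ℂ) ^ (z - 1) * Complex.exp (-(a * x))) -
      ∑ n ∈ Finset.range k, (-a) ^ n / n.factorial * (z - (-(n : ℂ)))⁻¹‖ ≤
      4 * (‖a‖ ^ k / k.factorial) := by
  have hpow : ∀ n : ℕ, IntegrableOn (fun x : ℝ => (x : ℂ) ^ (z + n - 1)) (Set.Ioc 0 1) ∧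
      ∫ x : ℝ in Set.Ioc 0 1, (x : ℂ) ^ (z + n - 1) = (z - (-(n : ℂ)))⁻¹ := fun n => by
    have hre : -1 < (z + n - 1).re := by
      have : (0 : ℝ) ≤ n := n.cast_nonneg
      simp only [Complex.sub_re, Complex.add_re, Complex.natCast_re, Complex.one_re, hz]
      linarith
    have hne : z + n ≠ 0 := fun h => by
      rw [h] at hre
      simp at hre
    refine ⟨(intervalIntegrable_iff_integrableOn_Ioc_of_le zero_le_one).1
      (intervalIntegral.intervalIntegrable_cpow' hre), ?_⟩
    rw [← intervalIntegral.integral_of_le zero_le_one, integral_cpow (Or.inl hre)]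
    simp [Complex.zero_cpow hne]
  have hterm : ∀ n : ℕ, ∀ x ∈ Set.Ioc (0 : ℝ) 1,
      (-a) ^ n / n.factorial * (x : ℂ) ^ (z + n - 1) =
        (x : ℂ) ^ (z - 1) * ((-(a * x)) ^ n / n.factorial) := fun n x hx => by
    have hx0 : (x : ℂ) ≠ 0 := Complex.ofReal_ne_zero.2 hx.1.ne'
    rw [show z + n - 1 = (z - 1) + n by ring, Complex.cpow_add _ _ hx0, Complex.cpow_natCast,
      ← neg_mul, mul_pow]
    ring
  have hsum : ∑ n ∈ Finset.range k, (-a) ^ n / n.factorial * (z - (-(n : ℂ)))⁻¹ =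
      ∫ x : ℝ in Set.Ioc 0 1, ∑ n ∈ Finset.range k,
        (-a) ^ n / n.factorial * (x : ℂ) ^ (z + n - 1) := by
    rw [integral_finsetSum _ fun n _ => ((hpow n).1.const_mul _)]
    refine Finset.sum_congr rfl fun n _ => ?_
    rw [integral_const_mul, (hpow n).2]
  rw [hsum, ← integral_sub (integrableOn_cpow_mul_exp_Ioc ha.ge (by rw [hz]; norm_num))
    (integrable_finsetSum _ fun n _ => ((hpow n).1.const_mul _)),
    setIntegral_congr_fun (g := fun x : ℝ => (x : ℂ) ^ (z - 1) * (Complex.exp (-(a * x)) -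
      ∑ n ∈ Finset.range k, (-(a * x)) ^ n / n.factorial)) measurableSet_Ioc fun x hx => by
        simp only
        rw [Finset.sum_congr rfl fun n _ => hterm n x hx, ← Finset.mul_sum, mul_sub]]
  -- The Taylor remainder of the exponential is at most `2 ‖a‖ ^ k / k!`; integrating against `x ^
  -- (-1/2)` gives the second factor `2`.
  refine (norm_integral_cpow_mul_le hz (D := ‖a‖ ^ k / k.factorial * 2) fun x hx => ?_).trans
    (le_of_eq (by ring))
  have hle : ‖-(a * (x : ℂ))‖ ≤ ‖a‖ := by
    rw [norm_neg, norm_mul, Complex.norm_real, Real.norm_of_nonneg hx.1.le]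
    exact mul_le_of_le_one_right (norm_nonneg _) hx.2
  refine (Complex.exp_bound' (le_trans (by gcongr) hk)).trans ?_
  gcongr

end QuasiInner

namespace QuasiInner

/-! ### The archimedean factor -/

theorem one_sub_eq_conj {z : ℂ} (hz : z.re = 1 / 2) : 1 - z = (starRingEnd ℂ) z := by
  apply Complex.ext
  · simp [hz]; norm_num
  · simp

theorem Gammaℝ_conj (z : ℂ) :
    Complex.Gammaℝ ((starRingEnd ℂ) z) = (starRingEnd ℂ) (Complex.Gammaℝ z) := by
  have h2 : (starRingEnd ℂ) z / 2 = (starRingEnd ℂ) (z / 2) := by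
    rw [map_div₀, map_ofNat]
  have hpi : (Real.pi : ℂ) ^ (-(starRingEnd ℂ) z / 2) =
      (starRingEnd ℂ) ((Real.pi : ℂ) ^ (-z / 2)) := by
    have h := Complex.cpow_conj (Real.pi : ℂ) (-z / 2)
      (by rw [Complex.arg_ofReal_of_nonneg Real.pi_pos.le]; exact Real.pi_pos.ne)
    rw [Complex.conj_ofReal] at h
    rw [← h, map_div₀, map_neg, map_ofNat]
  rw [Complex.Gammaℝ_def, Complex.Gammaℝ_def, h2, Complex.Gamma_conj, hpi, map_mul]

theorem norm_localRatio_archimedean {z : ℂ} (hz : z.re = 1 / 2) :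
    ‖localRatio .archimedean z‖ = 1 := by
  have hne : Complex.Gammaℝ z ≠ 0 := Complex.Gammaℝ_ne_zero_of_re_pos (by rw [hz]; norm_num)
  simp only [localRatio, localFactor]
  rw [one_sub_eq_conj hz, Gammaℝ_conj, norm_div, RCLike.norm_conj]
  exact div_self (norm_ne_zero_iff.2 hne)

theorem continuous_localRatio_archimedean :
    Continuous fun s => localRatio .archimedean (linePoint (1 / 2) s) := by
  have h : ∀ z : ℂ, localRatio .archimedean z =
      (Complex.Gammaℝ (1 - z))⁻¹ * ((Complex.Gammaℝ z)⁻¹)⁻¹ := fun z => by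
    rw [inv_inv, localRatio, div_eq_inv_mul]
    rfl
  simp_rw [h]
  have hc := Complex.differentiable_Gammaℝ_inv.continuous
  refine (hc.comp (continuous_const.sub (continuous_linePoint _))).mul
    ((hc.comp (continuous_linePoint _)).inv₀ fun s => ?_)
  refine inv_ne_zero (Complex.Gammaℝ_ne_zero_of_re_pos ?_)
  rw [re_linePoint]
  norm_num

/-- By the duplication and reflection formulas `ρ_∞(z) = 2 (2π) ^ (-z) Γ(z) cos(πz/2)`, and `2
cos(πz/2) = I ^ (-z) + (-I) ^ (-z)`. -/
theorem cpow_neg_mul_localRatio_archimedean {q : ℕ} (hq : 1 ≤ q) {z : ℂ} (hz : z.re = 1 / 2) :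
    (q : ℂ) ^ (-z) * localRatio .archimedean z =
      Complex.Gamma z * (((2 * Real.pi * q : ℝ) : ℂ) * Complex.I) ^ (-z) +
        Complex.Gamma z * (((2 * Real.pi * q : ℝ) : ℂ) * -Complex.I) ^ (-z) := by
  have hq0 : (0 : ℝ) < q := by exact_mod_cast hq
  have hpi := Real.pi_pos
  have hy : (0 : ℝ) < 2 * Real.pi * q := by positivity
  have hratio : localRatio .archimedean z =
      2 * (2 * Real.pi) ^ (-z) * Complex.Gamma z * Complex.cos (Real.pi * z / 2) := by
    have := Complex.Gammaℝ_div_Gammaℝ_one_sub (s := z) fun n h => by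
      rw [h] at hz
      simp only [Complex.neg_re, Complex.add_re, Complex.mul_re, Complex.re_ofNat,
        Complex.natCast_re, Complex.im_ofNat, Complex.natCast_im, mul_zero, sub_zero,
        Complex.one_re] at hz
      have : (0 : ℝ) ≤ n := n.cast_nonneg
      linarith
    rwa [Complex.Gammaℂ_def] at this
  have hpow : ((2 * Real.pi * q : ℝ) : ℂ) ^ (-z) = (2 * Real.pi) ^ (-z) * (q : ℂ) ^ (-z) := by
    have := Complex.mul_cpow_ofReal_nonneg (a := 2 * Real.pi) (b := q) (by positivity) hq0.le (-z)
    push_cast at this ⊢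
    exact this
  have hI : ∀ w : ℂ, w ≠ 0 → (((2 * Real.pi * q : ℝ) : ℂ) * w) ^ (-z) =
      ((2 * Real.pi * q : ℝ) : ℂ) ^ (-z) * w ^ (-z) := fun w hw => by
    rw [Complex.cpow_def_of_ne_zero (mul_ne_zero (Complex.ofReal_ne_zero.2 hy.ne') hw),
      Complex.log_ofReal_mul hy hw, Complex.cpow_def_of_ne_zero (Complex.ofReal_ne_zero.2 hy.ne'),
      Complex.cpow_def_of_ne_zero hw, ← Complex.exp_add, Complex.ofReal_log hy.le]
    ring_nf
  rw [hI _ Complex.I_ne_zero, hI _ (neg_ne_zero.2 Complex.I_ne_zero), hratio, hpow,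
    Complex.cpow_def_of_ne_zero Complex.I_ne_zero,
    Complex.cpow_def_of_ne_zero (neg_ne_zero.2 Complex.I_ne_zero), Complex.log_I,
    Complex.log_neg_I, Complex.cos]
  ring_nf

/-- The holomorphic part of `q ^ (-z) * ρ_∞(z)`. -/
noncomputable def holomorphicPart (q : ℕ) (z : ℂ) : ℂ :=
  upperMellin (((2 * Real.pi * q : ℝ) : ℂ) * Complex.I) z +
    upperMellin (((2 * Real.pi * q : ℝ) : ℂ) * -Complex.I) z

theorem differentiableOn_holomorphicPart (q : ℕ) :
    DifferentiableOn ℂ (holomorphicPart q) {z : ℂ | z.re < 1} :=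
  (differentiableOn_upperMellin (by simp)).add (differentiableOn_upperMellin (by simp))

theorem norm_frequency {q : ℕ} :
    ‖((2 * Real.pi * q : ℝ) : ℂ) * Complex.I‖ = 2 * Real.pi * q ∧
      ‖((2 * Real.pi * q : ℝ) : ℂ) * -Complex.I‖ = 2 * Real.pi * q := by
  have : (0 : ℝ) ≤ 2 * Real.pi * q := by positivity
  constructor <;>
  · rw [norm_mul, Complex.norm_real, Real.norm_of_nonneg this]
    simp

theorem norm_holomorphicPart_le_linear {q : ℕ} (hq : 1 ≤ q) {z : ℂ} (hz : z.re < 1) :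
    ‖holomorphicPart q z‖ ≤ 1 + ‖z - 1‖ / (1 - z.re) := by
  have h1 := norm_upperMellin_le (a := ((2 * Real.pi * q : ℝ) : ℂ) * Complex.I) (by simp) hz
  have h2 := norm_upperMellin_le (a := ((2 * Real.pi * q : ℝ) : ℂ) * -Complex.I) (by simp) hz
  rw [norm_frequency.1] at h1
  rw [norm_frequency.2] at h2
  have hq' : (1 : ℝ) ≤ q := by exact_mod_cast hq
  have h3 : (2 * Real.pi * q)⁻¹ ≤ (2 : ℝ)⁻¹ := by
    gcongr
    nlinarith [Real.pi_gt_three]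
  have h4 : 0 ≤ 1 + ‖z - 1‖ / (1 - z.re) := by
    have := sub_pos.2 hz
    positivity
  have h5 := mul_le_mul_of_nonneg_right h3 h4
  refine (norm_add_le _ _).trans ?_
  linarith

theorem frequency_ne_zero {q : ℕ} (hq : 1 ≤ q) {w : ℂ} (hw : w ≠ 0) :
    ((2 * Real.pi * q : ℝ) : ℂ) * w ≠ 0 := by
  have hq0 : (0 : ℝ) < q := by exact_mod_cast hq
  exact mul_ne_zero (Complex.ofReal_ne_zero.2 (by positivity)) hw

theorem cpow_neg_mul_localRatio_archimedean_sub {q : ℕ} (hq : 1 ≤ q) {z : ℂ}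
    (hz : z.re = 1 / 2) :
    (q : ℂ) ^ (-z) * localRatio .archimedean z - holomorphicPart q z =
      (∫ x : ℝ in Set.Ioc 0 1, (x : ℂ) ^ (z - 1) *
        Complex.exp (-(((2 * Real.pi * q : ℝ) : ℂ) * Complex.I * x))) +
      ∫ x : ℝ in Set.Ioc 0 1, (x : ℂ) ^ (z - 1) *
        Complex.exp (-(((2 * Real.pi * q : ℝ) : ℂ) * -Complex.I * x)) := by
  have hz0 : 0 < z.re := by rw [hz]; norm_num
  have hz1 : z.re < 1 := by rw [hz]; norm_num
  rw [cpow_neg_mul_localRatio_archimedean hq hz,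
    Gamma_mul_cpow_eq (by simp) (frequency_ne_zero hq Complex.I_ne_zero) hz0 hz1,
    Gamma_mul_cpow_eq (by simp) (frequency_ne_zero hq (neg_ne_zero.2 Complex.I_ne_zero)) hz0 hz1,
    holomorphicPart]
  ring

theorem norm_natCast_cpow_neg_le_one {q : ℕ} (hq : 1 ≤ q) {z : ℂ} (hz : 0 ≤ z.re) :
    ‖(q : ℂ) ^ (-z)‖ ≤ 1 := by
  rw [Complex.norm_natCast_cpow_of_pos hq, Complex.neg_re]
  exact Real.rpow_le_one_of_one_le_of_nonpos (by exact_mod_cast hq) (by linarith)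

/-- On the critical line the holomorphic part is a symbol of modulus at most `1` minus two integrals
over `(0, 1]`, each at most `2`; the bound does not depend on `q`. -/
theorem norm_holomorphicPart_le_of_re_eq {q : ℕ} (hq : 1 ≤ q) {z : ℂ} (hz : z.re = 1 / 2) :
    ‖holomorphicPart q z‖ ≤ 5 := by
  have h := cpow_neg_mul_localRatio_archimedean_sub hq hz
  have hbd : ∀ w : ℂ, w.re = 0 → ‖∫ x : ℝ in Set.Ioc 0 1, (x : ℂ) ^ (z - 1) *
      Complex.exp (-(((2 * Real.pi * q : ℝ) : ℂ) * w * x))‖ ≤ 2 * 1 := fun w hw =>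
    norm_integral_cpow_mul_le hz fun x hx => norm_cexp_neg_mul_le_one
      (by rw [Complex.re_ofReal_mul, hw, mul_zero]) hx.1
  have h1 := hbd Complex.I (by simp)
  have h2 := hbd (-Complex.I) (by simp)
  have h3 : ‖(q : ℂ) ^ (-z) * localRatio .archimedean z‖ ≤ 1 := by
    rw [norm_mul, norm_localRatio_archimedean hz, mul_one]
    exact norm_natCast_cpow_neg_le_one hq (by rw [hz]; norm_num)
  rw [show holomorphicPart q z = (q : ℂ) ^ (-z) * localRatio .archimedean z -
    ((q : ℂ) ^ (-z) * localRatio .archimedean z - holomorphicPart q z) by ring, h]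
  refine (norm_sub_le _ _).trans ?_
  have h4 := norm_add_le (∫ x : ℝ in Set.Ioc 0 1, (x : ℂ) ^ (z - 1) *
        Complex.exp (-(((2 * Real.pi * q : ℝ) : ℂ) * Complex.I * x)))
      (∫ x : ℝ in Set.Ioc 0 1, (x : ℂ) ^ (z - 1) *
        Complex.exp (-(((2 * Real.pi * q : ℝ) : ℂ) * -Complex.I * x)))
  linarith

/-- Phragmén–Lindelöf carries the bound from the critical line into the half-plane, after the
reflection `w = 1/2 - z`. The growth is at most linear, and on the real axis `‖z - 1‖ = 1 - Re z`
bounds the function by `2`. -/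
theorem norm_holomorphicPart_le {q : ℕ} (hq : 1 ≤ q) {z : ℂ} (hz : z.re ≤ 1 / 2) :
    ‖holomorphicPart q z‖ ≤ 5 := by
  have hmaps : ∀ w : ℂ, 0 ≤ w.re → (1 / 2 - w).re < 1 := fun w hw => by
    rw [Complex.sub_re, show (1 / 2 : ℂ).re = 1 / 2 by simp]
    linarith
  have hd : ∀ w : ℂ, 0 ≤ w.re → DifferentiableAt ℂ (fun w => holomorphicPart q (1 / 2 - w)) w :=
    fun w hw => DifferentiableAt.comp (f := fun w : ℂ => 1 / 2 - w) w
      ((differentiableOn_holomorphicPart q).differentiableAt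
        ((isOpen_lt Complex.continuous_re continuous_const).mem_nhds (hmaps w hw))) (by fun_prop)
  have hclosure : closure {w : ℂ | 0 < w.re} = {w : ℂ | 0 ≤ w.re} := by
    exact Complex.closure_setOfPred_lt_re 0
  have hdc : DiffContOnCl ℂ (fun w => holomorphicPart q (1 / 2 - w)) {w : ℂ | 0 < w.re} := by
    refine DifferentiableOn.diffContOnCl ?_
    rw [hclosure]
    exact fun w hw => (hd w hw).differentiableWithinAt
  have key := PhragmenLindelof.right_half_plane_of_bounded_on_real (C := 5) (z := 1 / 2 - z) hdc
    ⟨1, by norm_num, 1, ?_⟩ ?_ ?_ ?_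
  · simpa using key
  · refine Asymptotics.IsBigO.of_bound 3 ?_
    filter_upwards [mem_inf_of_right (mem_principal_self _)] with w hw
    have hw' : 0 < w.re := hw
    have h1 := norm_holomorphicPart_le_linear hq (hmaps w hw'.le)
    have hre : 1 - (1 / 2 - w).re = 1 / 2 + w.re := by
      rw [Complex.sub_re, show (1 / 2 : ℂ).re = 1 / 2 by simp]
      ring
    have h2 : ‖(1 / 2 - w) - 1‖ ≤ 1 / 2 + ‖w‖ := by
      rw [show (1 / 2 - w) - 1 = -((1 / 2 : ℂ) + w) by ring, norm_neg]
      refine (norm_add_le _ _).trans ?_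
      norm_num
    have h3 : ‖(1 / 2 - w) - 1‖ / (1 - (1 / 2 - w).re) ≤ 1 + 2 * ‖w‖ := by
      rw [hre, div_le_iff₀ (by linarith)]
      nlinarith [norm_nonneg w]
    have h4 := Real.add_one_le_exp ‖w‖
    rw [Real.rpow_one, one_mul, Real.norm_of_nonneg (Real.exp_pos _).le]
    linarith [norm_nonneg w]
  · refine ⟨2, ?_⟩
    rw [eventually_map]
    filter_upwards [eventually_ge_atTop 0] with x hx
    have h1 := norm_holomorphicPart_le_linear hq (hmaps x (by simpa using hx))
    have h2 : ‖(1 / 2 - (x : ℂ)) - 1‖ = 1 / 2 + x := by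
      rw [show (1 / 2 - (x : ℂ)) - 1 = ((-(1 / 2 + x) : ℝ) : ℂ) by push_cast; ring,
        Complex.norm_real, norm_neg, Real.norm_of_nonneg (by linarith)]
    have h3 : 1 - (1 / 2 - (x : ℂ)).re = 1 / 2 + x := by
      rw [Complex.sub_re, show (1 / 2 : ℂ).re = 1 / 2 by simp, Complex.ofReal_re]
      ring
    rw [h2, h3, div_self (by linarith)] at h1
    linarith
  · intro x
    exact norm_holomorphicPart_le_of_re_eq hq (by simp)
  · rw [Complex.sub_re, show (1 / 2 : ℂ).re = 1 / 2 by simp]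
    linarith

/-- The symbol `q ^ (-z) * ρ_∞(z)` is the sum of `k` simple poles, of a bounded holomorphic
function, and of a small error. -/
theorem norm_cpow_neg_mul_localRatio_archimedean_sub_le {q : ℕ} (hq : 1 ≤ q) {k : ℕ}
    (hk : 2 * Real.pi * q / k.succ ≤ 1 / 2) {z : ℂ} (hz : z.re = 1 / 2) :
    ‖(q : ℂ) ^ (-z) * localRatio .archimedean z -
      ∑ n ∈ Finset.range k, ((-(((2 * Real.pi * q : ℝ) : ℂ) * Complex.I)) ^ n / n.factorial +
        (-(((2 * Real.pi * q : ℝ) : ℂ) * -Complex.I)) ^ n / n.factorial) *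
          (z - (-(n : ℂ)))⁻¹ - holomorphicPart q z‖ ≤
      8 * ((2 * Real.pi * q) ^ k / k.factorial) := by
  have h1 := norm_integral_cpow_mul_exp_sub_sum_le (a := ((2 * Real.pi * q : ℝ) : ℂ) * Complex.I)
    (by simp) hz (k := k) (by rwa [norm_frequency.1])
  have h2 := norm_integral_cpow_mul_exp_sub_sum_le (a := ((2 * Real.pi * q : ℝ) : ℂ) * -Complex.I)
    (by simp) hz (k := k) (by rwa [norm_frequency.2])
  rw [norm_frequency.1] at h1
  rw [norm_frequency.2] at h2
  rw [sub_right_comm, cpow_neg_mul_localRatio_archimedean_sub hq hz]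
  simp only [add_mul, Finset.sum_add_distrib]
  rw [add_sub_add_comm]
  refine (norm_add_le _ _).trans ?_
  linarith

end QuasiInner

namespace QuasiInner

/-! ### Infinitesimals -/

section Infinitesimal

variable {H : Type*} [NormedAddCommGroup H] [InnerProductSpace ℂ H]

theorem characteristicValue_nonneg (n : ℕ) (T : H →L[ℂ] H) : 0 ≤ characteristicValue n T := by
  refine Real.sInf_nonneg ?_
  rintro _ ⟨R, _, rfl⟩
  exact norm_nonneg _

theorem characteristicValue_le {n : ℕ} {T R : H →L[ℂ] H}
    (hR : LinearMap.rank (R : H →ₗ[ℂ] H) ≤ n) : characteristicValue n T ≤ ‖T - R‖ := by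
  refine csInf_le ⟨0, ?_⟩ ⟨R, hR, rfl⟩
  rintro _ ⟨R, _, rfl⟩
  exact norm_nonneg _

theorem isCompactOperator_of_rank_le {n : ℕ} {R : H →L[ℂ] H}
    (hR : LinearMap.rank (R : H →ₗ[ℂ] H) ≤ n) : IsCompactOperator R := by
  have hfin : FiniteDimensional ℂ (LinearMap.range (R : H →ₗ[ℂ] H)) :=
    Module.rank_lt_aleph0_iff.1 (hR.trans_lt (Cardinal.natCast_lt_aleph0))
  have : ProperSpace (LinearMap.range (R : H →ₗ[ℂ] H)) := FiniteDimensional.proper ℂ _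
  have h := isCompactOperator_of_locallyCompactSpace_dom
    (R.codRestrict (LinearMap.range (R : H →ₗ[ℂ] H)) fun x => ⟨x, rfl⟩)
  exact h.clm_comp (LinearMap.range (R : H →ₗ[ℂ] H)).subtypeL

/-- The finite rank approximants bound `μ_n` directly, and they give compactness because compact
operators form a norm-closed set. -/
theorem isInfinitesimalOfOrder_of_approx [CompleteSpace H] {T : H →L[ℂ] H} {α C : ℝ} (hα : 0 < α)
    (h : ∀ᶠ n : ℕ in atTop, ∃ R : H →L[ℂ] H, LinearMap.rank (R : H →ₗ[ℂ] H) ≤ n ∧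
      ‖T - R‖ ≤ C * (n : ℝ) ^ (-α)) : IsInfinitesimalOfOrder α T := by
  constructor
  · have hclosed := isClosed_setOfPred_isCompactOperator (𝕜₁ := ℂ) (𝕜₂ := ℂ)
      (σ₁₂ := RingHom.id ℂ) (M₁ := H) (M₂ := H)
    have hlim : Tendsto (fun n : ℕ => C * (n : ℝ) ^ (-α)) atTop (𝓝 0) := by
      simpa using ((tendsto_rpow_neg_atTop hα).comp tendsto_natCast_atTop_atTop).const_mul C
    refine hclosed.closure_subset (Metric.mem_closure_iff.2 fun ε hε => ?_)
    obtain ⟨n, ⟨R, hR, hTR⟩, hn⟩ := (h.and (hlim.eventually_lt_const hε)).exists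
    exact ⟨R, isCompactOperator_of_rank_le hR, by rw [dist_eq_norm]; exact hTR.trans_lt hn⟩
  · refine Asymptotics.IsBigO.of_bound C ?_
    filter_upwards [h] with n hn
    obtain ⟨R, hR, hTR⟩ := hn
    rw [Real.norm_of_nonneg (characteristicValue_nonneg n T),
      Real.norm_of_nonneg (by positivity)]
    exact (characteristicValue_le hR).trans hTR

end Infinitesimal

/-! ### The factors at the primes -/

theorem norm_cpow_neg_eq {p : ℕ} (hp : 2 ≤ p) {z : ℂ} (hz : z.re = 1 / 2) :
    ‖(p : ℂ) ^ (-z)‖ = (p : ℝ) ^ (-(1 / 2) : ℝ) := by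
  rw [Complex.norm_natCast_cpow_of_pos (by omega), Complex.neg_re, hz]

theorem rpow_neg_half_le {p : ℕ} (hp : 2 ≤ p) : (p : ℝ) ^ (-(1 / 2) : ℝ) ≤ 3 / 4 := by
  have hp' : (2 : ℝ) ≤ p := by exact_mod_cast hp
  rw [Real.rpow_neg (by positivity), ← Real.sqrt_eq_rpow]
  have : (4 / 3 : ℝ) ≤ Real.sqrt p := Real.le_sqrt_of_sq_le (by norm_num; linarith)
  calc (Real.sqrt p)⁻¹ ≤ (4 / 3 : ℝ)⁻¹ := by gcongr
    _ = 3 / 4 := by norm_num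

theorem quarter_le_norm_one_sub_cpow {p : ℕ} (hp : 2 ≤ p) {z : ℂ} (hz : z.re = 1 / 2) :
    1 / 4 ≤ ‖1 - (p : ℂ) ^ (-z)‖ := by
  have h1 := norm_sub_norm_le (1 : ℂ) ((p : ℂ) ^ (-z))
  rw [norm_one, norm_cpow_neg_eq hp hz] at h1
  linarith [rpow_neg_half_le hp]

theorem one_sub_cpow_ne_zero {p : ℕ} (hp : 2 ≤ p) {z : ℂ} (hz : z.re = 1 / 2) :
    1 - (p : ℂ) ^ (-z) ≠ 0 :=
  norm_pos_iff.1 ((by norm_num : (0 : ℝ) < 1 / 4).trans_le (quarter_le_norm_one_sub_cpow hp hz))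

theorem norm_inv_one_sub_cpow_le {p : ℕ} (hp : 2 ≤ p) {z : ℂ} (hz : z.re = 1 / 2) :
    ‖(1 - (p : ℂ) ^ (-z))⁻¹‖ ≤ 4 := by
  rw [norm_inv]
  calc ‖1 - (p : ℂ) ^ (-z)‖⁻¹ ≤ (1 / 4 : ℝ)⁻¹ := by
        gcongr
        exact quarter_le_norm_one_sub_cpow hp hz
    _ = 4 := by norm_num

theorem localRatio_prime (p : Nat.Primes) (z : ℂ) :
    localRatio (.prime p) z =
      (1 - ((p : ℕ) : ℂ) ^ (-z))⁻¹ * (1 - ((p : ℕ) : ℂ) ^ (-(1 - z))) := by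
  simp [localRatio, localFactor]

theorem norm_localRatio_prime (p : Nat.Primes) {z : ℂ} (hz : z.re = 1 / 2) :
    ‖localRatio (.prime p) z‖ = 1 := by
  have hconj : 1 - ((p : ℕ) : ℂ) ^ (-(1 - z)) =
      (starRingEnd ℂ) (1 - ((p : ℕ) : ℂ) ^ (-z)) := by
    have h := Complex.cpow_conj ((p : ℕ) : ℂ) (-z)
      (by rw [Complex.natCast_arg]; exact Real.pi_pos.ne)
    rw [Complex.conj_natCast] at h
    rw [one_sub_eq_conj hz, ← map_neg, h, map_sub, map_one]
  rw [localRatio_prime, hconj, norm_mul, norm_inv, RCLike.norm_conj]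
  exact inv_mul_cancel₀ (norm_ne_zero_iff.2 (one_sub_cpow_ne_zero p.2.two_le hz))

theorem inv_one_sub_sub_geom_sum {w : ℂ} (hw : 1 - w ≠ 0) (N : ℕ) :
    (1 - w)⁻¹ - ∑ n ∈ Finset.range N, w ^ n = w ^ N * (1 - w)⁻¹ := by
  have h := mul_neg_geom_sum w N
  field_simp
  rw [h]
  ring

/-- The length `Nat.clog p X` is the least `N` with `X ≤ p ^ N`: long enough for this error, short
enough that the powers kept stay at most `X`. -/
theorem rpow_neg_half_pow_clog_le {p X : ℕ} (hp : 2 ≤ p) (hX : 1 ≤ X) :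
    ((p : ℝ) ^ (-(1 / 2) : ℝ)) ^ Nat.clog p X ≤ (X : ℝ) ^ (-(1 / 2) : ℝ) := by
  have hX0 : (0 : ℝ) < X := by exact_mod_cast hX
  have h : (X : ℝ) ≤ (p : ℝ) ^ Nat.clog p X := by exact_mod_cast Nat.le_pow_clog (by omega) X
  rw [← Real.rpow_natCast, ← Real.rpow_mul (by positivity), mul_comm,
    Real.rpow_mul (by positivity), Real.rpow_natCast]
  exact Real.rpow_le_rpow_of_nonpos hX0 h (by norm_num)

theorem norm_inv_one_sub_cpow_sub_geom_sum_le {p X : ℕ} (hp : 2 ≤ p) (hX : 1 ≤ X) {z : ℂ}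
    (hz : z.re = 1 / 2) :
    ‖(1 - (p : ℂ) ^ (-z))⁻¹ - ∑ n ∈ Finset.range (Nat.clog p X), ((p : ℂ) ^ (-z)) ^ n‖ ≤
      4 * (X : ℝ) ^ (-(1 / 2) : ℝ) := by
  rw [inv_one_sub_sub_geom_sum (one_sub_cpow_ne_zero hp hz), norm_mul, norm_pow,
    norm_cpow_neg_eq hp hz, mul_comm]
  exact mul_le_mul (norm_inv_one_sub_cpow_le hp hz) (rpow_neg_half_pow_clog_le hp hX)
    (by positivity) (by norm_num)

/-- Factors are exchanged one at a time; `B ≥ 1` makes the powers of `B` uniform. -/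
theorem norm_prod_sub_prod_le {ι : Type*} (s : Finset ι) {a b : ι → ℂ} {B δ : ℝ} (hB : 1 ≤ B)
    (hδ : 0 ≤ δ) (ha : ∀ i, ‖a i‖ ≤ B) (hb : ∀ i, ‖b i‖ ≤ B) (hab : ∀ i, ‖a i - b i‖ ≤ δ) :
    ‖∏ i ∈ s, a i - ∏ i ∈ s, b i‖ ≤ s.card * B ^ s.card * δ := by
  classical
  induction s using Finset.induction_on with
  | empty => simp
  | insert i s his ih =>
    rw [Finset.prod_insert his, Finset.prod_insert his, Finset.card_insert_of_notMem his,
      show a i * ∏ i ∈ s, a i - b i * ∏ i ∈ s, b i =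
        (a i - b i) * ∏ i ∈ s, a i + b i * (∏ i ∈ s, a i - ∏ i ∈ s, b i) by ring]
    have h1 : ‖∏ i ∈ s, a i‖ ≤ B ^ s.card := by
      rw [norm_prod]
      exact (Finset.prod_le_prod (fun _ _ => norm_nonneg _) fun i _ => ha i).trans (by simp)
    calc ‖(a i - b i) * ∏ i ∈ s, a i + b i * (∏ i ∈ s, a i - ∏ i ∈ s, b i)‖
        ≤ ‖a i - b i‖ * ‖∏ i ∈ s, a i‖ + ‖b i‖ * ‖∏ i ∈ s, a i - ∏ i ∈ s, b i‖ :=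
          (norm_add_le _ _).trans (by rw [norm_mul, norm_mul])
      _ ≤ δ * B ^ s.card + B * (s.card * B ^ s.card * δ) := by
          gcongr
          · exact hab i
          · exact hb i
      _ ≤ δ * (B ^ s.card * B) + B * (s.card * B ^ s.card * δ) := by
          gcongr
          exact le_mul_of_one_le_right (by positivity) hB
      _ = ((s.card + 1 : ℕ) : ℝ) * B ^ (s.card + 1) * δ := by
          push_cast
          ring

theorem natCast_prod_cpow {ι : Type*} (s : Finset ι) (f : ι → ℕ) (z : ℂ) :
    ((∏ i ∈ s, f i : ℕ) : ℂ) ^ z = ∏ i ∈ s, (f i : ℂ) ^ z := by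
  classical
  induction s using Finset.induction_on with
  | empty => simp
  | insert i s his ih =>
    rw [Finset.prod_insert his, Finset.prod_insert his, Nat.cast_mul,
      Complex.natCast_mul_natCast_cpow, ih]

/-! ### Truncated Euler products -/

section EulerProduct

variable {ι : Type*} [Fintype ι] [DecidableEq ι]

theorem prod_geom_sum_eq_sum (p N : ι → ℕ) (z : ℂ) :
    ∏ i, ∑ n ∈ Finset.range (N i), ((p i : ℂ) ^ (-z)) ^ n =
      ∑ x ∈ Fintype.piFinset fun i => Finset.range (N i),
        ((∏ i, p i ^ x i : ℕ) : ℂ) ^ (-z) := by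
  rw [Finset.prod_univ_sum]
  refine Finset.sum_congr rfl fun x _ => ?_
  rw [natCast_prod_cpow]
  refine Finset.prod_congr rfl fun i _ => ?_
  rw [Nat.cast_pow, ← Complex.natCast_cpow_natCast_mul, ← Complex.cpow_nat_mul]

theorem prod_pow_le_of_mem {p : ι → ℕ} (hp : ∀ i, 2 ≤ p i) {X : ℕ} {x : ι → ℕ}
    (hx : x ∈ Fintype.piFinset fun i => Finset.range (Nat.clog (p i) X)) :
    ∏ i, p i ^ x i ≤ X ^ Fintype.card ι := by
  refine (Finset.prod_le_pow_card _ _ X fun i _ => ?_).trans (by simp)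
  have hi := Finset.mem_range.1 (Fintype.mem_piFinset.1 hx i)
  by_contra! h
  exact absurd ((Nat.clog_le_iff_le_pow (hp i)).2 h.le) (not_le.2 hi)

/-- A crude count, from `X ≤ p ^ X`; the geometric decay in `k` absorbs it later. -/
theorem card_piFinset_clog_le {p : ι → ℕ} (hp : ∀ i, 2 ≤ p i) (X : ℕ) :
    (Fintype.piFinset fun i => Finset.range (Nat.clog (p i) X)).card ≤ X ^ Fintype.card ι := by
  rw [Fintype.card_piFinset]
  refine (Finset.prod_le_pow_card _ _ X fun i _ => ?_).trans (by simp)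
  rw [Finset.card_range]
  exact (Nat.clog_le_iff_le_pow (hp i)).2 (Nat.lt_pow_self (hp i)).le

/-- The product of `ρ_∞` by the Euler factors is, up to an error, a sum of `k` simple poles and of
a bounded holomorphic function. -/
theorem exists_poles_add_holomorphic {p : ι → ℕ} (hp : ∀ i, 2 ≤ p i) {X k : ℕ} (hX : 1 ≤ X)
    (hk : 2 * Real.pi * (X ^ Fintype.card ι : ℕ) / k.succ ≤ 1 / 2) :
    ∃ (c : ℕ → ℂ) (b : ℂ → ℂ) (C : ℝ), DifferentiableOn ℂ b {z : ℂ | z.re < 1} ∧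
      (∀ z : ℂ, z.re ≤ 1 / 2 → ‖b z‖ ≤ C) ∧ ∀ z : ℂ, z.re = 1 / 2 →
      ‖localRatio .archimedean z * ∏ i, (1 - (p i : ℂ) ^ (-z))⁻¹ -
        ∑ n ∈ Finset.range k, c n * (z - (-(n : ℂ)))⁻¹ - b z‖ ≤
      Fintype.card ι * 8 ^ Fintype.card ι * (4 * (X : ℝ) ^ (-(1 / 2) : ℝ)) +
        (X ^ Fintype.card ι : ℕ) *
          (8 * ((2 * Real.pi * (X ^ Fintype.card ι : ℕ)) ^ k / k.factorial)) := by
  set Q : ℕ := X ^ Fintype.card ι with hQ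
  set A : Finset (ι → ℕ) := Fintype.piFinset fun i => Finset.range (Nat.clog (p i) X) with hA
  set q : (ι → ℕ) → ℕ := fun x => ∏ i, p i ^ x i with hq
  have hq1 : ∀ x, 1 ≤ q x := fun x =>
    Finset.one_le_prod' fun i _ => Nat.one_le_pow _ _ (by linarith [hp i])
  have hqQ : ∀ x ∈ A, (q x : ℝ) ≤ Q := fun x hx => by exact_mod_cast prod_pow_le_of_mem hp hx
  have hX1 : (X : ℝ) ^ (-(1 / 2) : ℝ) ≤ 1 :=
    Real.rpow_le_one_of_one_le_of_nonpos (by exact_mod_cast hX) (by norm_num)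
  let d : ℕ → ℕ → ℂ := fun r n =>
    (-(((2 * Real.pi * r : ℝ) : ℂ) * Complex.I)) ^ n / n.factorial +
      (-(((2 * Real.pi * r : ℝ) : ℂ) * -Complex.I)) ^ n / n.factorial
  -- The poles `-n` do not depend on `q`, so the residues are summed over `q` and the number of
  -- poles stays `k`.
  refine ⟨fun n => ∑ x ∈ A, d (q x) n, fun z => ∑ x ∈ A, holomorphicPart (q x) z, A.card * 5,
    DifferentiableOn.fun_sum fun x _ => differentiableOn_holomorphicPart _, fun z hz => ?_,
    fun z hz => ?_⟩
  · refine (norm_sum_le_of_le _ fun x _ => norm_holomorphicPart_le (hq1 x) hz).trans ?_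
    simp
  set D : ι → ℂ := fun i => ∑ n ∈ Finset.range (Nat.clog (p i) X), ((p i : ℂ) ^ (-z)) ^ n with hD
  have hdiff : ∀ i, ‖(1 - (p i : ℂ) ^ (-z))⁻¹ - D i‖ ≤ 4 * (X : ℝ) ^ (-(1 / 2) : ℝ) := fun i =>
    norm_inv_one_sub_cpow_sub_geom_sum_le (hp i) hX hz
  have hinv : ∀ i, ‖(1 - (p i : ℂ) ^ (-z))⁻¹‖ ≤ 4 := fun i => norm_inv_one_sub_cpow_le (hp i) hz
  -- The bound `8` is `4` for the full factor plus at most `4` for the truncation error, as `X ^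
  -- (-1/2) ≤ 1`.
  have hDle : ∀ i, ‖D i‖ ≤ 8 := fun i => by
    have := norm_sub_norm_le (D i) (1 - (p i : ℂ) ^ (-z))⁻¹
    rw [norm_sub_rev] at this
    linarith [hdiff i, hinv i]
  have hmain := norm_prod_sub_prod_le Finset.univ (by norm_num : (1 : ℝ) ≤ 8) (by positivity)
    (fun i => (hinv i).trans (by norm_num)) hDle hdiff
  rw [Finset.card_univ] at hmain
  have hsum : localRatio .archimedean z * ∏ i, (1 - (p i : ℂ) ^ (-z))⁻¹ -
      ∑ n ∈ Finset.range k, (∑ x ∈ A, d (q x) n) * (z - (-(n : ℂ)))⁻¹ -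
        ∑ x ∈ A, holomorphicPart (q x) z =
      localRatio .archimedean z * (∏ i, (1 - (p i : ℂ) ^ (-z))⁻¹ - ∏ i, D i) +
        ∑ x ∈ A, ((q x : ℂ) ^ (-z) * localRatio .archimedean z -
          ∑ n ∈ Finset.range k, d (q x) n * (z - (-(n : ℂ)))⁻¹ - holomorphicPart (q x) z) := by
    rw [Finset.sum_sub_distrib, Finset.sum_sub_distrib, ← Finset.sum_mul,
      ← prod_geom_sum_eq_sum p (fun i => Nat.clog (p i) X) z, Finset.sum_comm]
    simp_rw [Finset.sum_mul]
    ring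
  rw [hsum]
  refine (norm_add_le _ _).trans (add_le_add ?_ ?_)
  · rw [norm_mul, norm_localRatio_archimedean hz, one_mul]
    exact hmain
  · have hterm : ∀ x ∈ A, ‖(q x : ℂ) ^ (-z) * localRatio .archimedean z -
        ∑ n ∈ Finset.range k, d (q x) n * (z - (-(n : ℂ)))⁻¹ - holomorphicPart (q x) z‖ ≤
        8 * ((2 * Real.pi * Q) ^ k / k.factorial) := fun x hx => by
      have hpi := Real.pi_pos
      have hle := hqQ x hx
      refine (norm_cpow_neg_mul_localRatio_archimedean_sub_le (hq1 x)
        (le_trans (by gcongr) hk) hz).trans ?_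
      gcongr
    refine (norm_sum_le_of_le _ hterm).trans ?_
    rw [Finset.sum_const, nsmul_eq_mul]
    have hc : (A.card : ℝ) ≤ Q := by exact_mod_cast card_piFinset_clog_le hp X
    have hpi := Real.pi_pos
    gcongr

end EulerProduct

/-- Using `x ^ k / k! ≤ exp x` at the doubled argument `x = 4πQ` gains the factor `2 ^ (-k)`; then
`4π ≤ 13` and `e ≤ 4` give `2 ^ 26`. -/
theorem pow_div_factorial_le (Q k : ℕ) :
    (2 * Real.pi * Q) ^ k / k.factorial ≤ (2 ^ 26 : ℝ) ^ Q * (1 / 2) ^ k := by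
  have hpi := Real.pi_pos
  have h1 := Real.pow_div_factorial_le_exp (x := 2 * (2 * Real.pi * Q)) (by positivity) k
  have h2 : Real.exp (2 * (2 * Real.pi * Q)) ≤ (2 ^ 26 : ℝ) ^ Q := by
    have h3 : Real.exp 13 ≤ 2 ^ 26 := by
      have h4 : Real.exp 1 ≤ 4 := by linarith [Real.exp_one_lt_d9]
      calc Real.exp 13 = Real.exp 1 ^ 13 := by rw [← Real.exp_nat_mul]; norm_num
        _ ≤ 4 ^ 13 := by gcongr
        _ = 2 ^ 26 := by norm_num
    calc Real.exp (2 * (2 * Real.pi * Q)) ≤ Real.exp (Q * 13) := by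
          rw [Real.exp_le_exp]
          have : 4 * Real.pi ≤ 13 := by linarith [Real.pi_lt_d2]
          nlinarith [(Nat.cast_nonneg Q : (0 : ℝ) ≤ Q)]
      _ = Real.exp 13 ^ Q := Real.exp_nat_mul 13 Q
      _ ≤ (2 ^ 26 : ℝ) ^ Q := by gcongr
  calc (2 * Real.pi * Q) ^ k / k.factorial
      = (2 * (2 * Real.pi * Q)) ^ k / k.factorial * (1 / 2) ^ k := by
        rw [mul_pow 2 (2 * Real.pi * (Q : ℝ)), one_div, inv_pow]
        field_simp
    _ ≤ (2 ^ 26 : ℝ) ^ Q * (1 / 2) ^ k := by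
        gcongr
        exact h1.trans h2

end QuasiInner

namespace QuasiInner

/-! ### The product of the ratios -/

section RatioProduct

variable {ι : Type*} [Fintype ι]

/-- The product of the numerators `1 - p ^ (z - 1)`. -/
noncomputable def eulerNumerator (p : ι → Nat.Primes) (z : ℂ) : ℂ :=
  ∏ i, (1 - ((p i : ℕ) : ℂ) ^ (-(1 - z)))

theorem differentiable_eulerNumerator (p : ι → Nat.Primes) :
    Differentiable ℂ (eulerNumerator p) := by
  unfold eulerNumerator
  refine Differentiable.fun_finsetProd fun i _ => (differentiable_const _).sub ?_
  exact Differentiable.const_cpow (by fun_prop) (Or.inl (Nat.cast_ne_zero.2 (p i).2.ne_zero))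

theorem norm_eulerNumerator_le (p : ι → Nat.Primes) {z : ℂ} (hz : z.re ≤ 1 / 2) :
    ‖eulerNumerator p z‖ ≤ 2 ^ Fintype.card ι := by
  rw [eulerNumerator, norm_prod]
  refine (Finset.prod_le_prod (fun _ _ => norm_nonneg _) fun i _ => ?_).trans_eq
    (by rw [Finset.prod_const, Finset.card_univ])
  refine (norm_sub_le _ _).trans ?_
  have := norm_natCast_cpow_neg_le_one (q := p i) (z := 1 - z) (p i).2.one_le
    (by rw [Complex.sub_re, Complex.one_re]; linarith)
  rw [norm_one]
  linarith

theorem continuous_prod_inv (p : ι → Nat.Primes) :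
    Continuous fun s => ∏ i, (1 - ((p i : ℕ) : ℂ) ^ (-linePoint (1 / 2) s))⁻¹ := by
  refine continuous_finsetProd _ fun i _ => Continuous.inv₀ (continuous_const.sub ?_) fun s =>
    one_sub_cpow_ne_zero (p i).2.two_le (re_linePoint _ _)
  exact (continuous_linePoint _).neg.const_cpow (Or.inl (Nat.cast_ne_zero.2 (p i).2.ne_zero))

/-- Finite rank approximation of the off-diagonal part of `ρ_∞ ∏ ρ_p`. -/
theorem exists_rank_le_norm_offDiagonal_ratio_sub_le (p : ι → Nat.Primes)
    (hu : MemLp (fun s : ℝ => localRatio .archimedean (linePoint (1 / 2) s) *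
      ∏ i, localRatio (.prime (p i)) (linePoint (1 / 2) s)) ∞ volume) {X k : ℕ} (hX : 1 ≤ X)
    (hk : 13 * X ^ Fintype.card ι ≤ k) :
    ∃ R : BoundaryL2 →L[ℂ] BoundaryL2, LinearMap.rank (R : BoundaryL2 →ₗ[ℂ] BoundaryL2) ≤ k ∧
      ‖offDiagonal (hu.toLp _) - R‖ ≤
        (Fintype.card ι * 8 ^ Fintype.card ι * (4 * (X : ℝ) ^ (-(1 / 2) : ℝ)) +
        (X ^ Fintype.card ι : ℕ) * (8 * ((2 ^ 26 : ℝ) ^ (X ^ Fintype.card ι) * (1 / 2) ^ k))) *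
          2 ^ Fintype.card ι := by
  classical
  have hk' : 2 * Real.pi * (X ^ Fintype.card ι : ℕ) / k.succ ≤ 1 / 2 := by
    have h1 : (13 : ℝ) * (X ^ Fintype.card ι : ℕ) ≤ k := by exact_mod_cast hk
    have h2 : 4 * Real.pi ≤ 13 := by linarith [Real.pi_lt_d2]
    rw [div_le_iff₀ (by positivity), Nat.cast_succ]
    nlinarith [(Nat.cast_nonneg (X ^ Fintype.card ι) : (0 : ℝ) ≤ (X ^ Fintype.card ι : ℕ))]
  obtain ⟨c, b, C, hb, hbC, hbound⟩ :=
    exists_poles_add_holomorphic (p := fun i => (p i : ℕ)) (fun i => (p i).2.two_le) hX hk'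
  set ε : ℝ := Fintype.card ι * 8 ^ Fintype.card ι * (4 * (X : ℝ) ^ (-(1 / 2) : ℝ)) +
        (X ^ Fintype.card ι : ℕ) * (8 * ((2 ^ 26 : ℝ) ^ (X ^ Fintype.card ι) * (1 / 2) ^ k))
    with hε
  have hε0 : 0 ≤ ε := by positivity
  have hcont : Continuous fun s => localRatio .archimedean (linePoint (1 / 2) s) *
      ∏ i, (1 - ((p i : ℕ) : ℂ) ^ (-linePoint (1 / 2) s))⁻¹ :=
    continuous_localRatio_archimedean.mul (continuous_prod_inv p)
  have hv : MemLp (fun s : ℝ => localRatio .archimedean (linePoint (1 / 2) s) *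
      ∏ i, (1 - ((p i : ℕ) : ℂ) ^ (-linePoint (1 / 2) s))⁻¹) ∞ volume := by
    refine memLp_top_line (C := 4 ^ Fintype.card ι) (b := fun z => localRatio .archimedean z *
      ∏ i, (1 - ((p i : ℕ) : ℂ) ^ (-z))⁻¹) hcont fun z hz => ?_
    rw [norm_mul, norm_localRatio_archimedean hz, one_mul, norm_prod]
    exact (Finset.prod_le_prod (fun _ _ => norm_nonneg _) fun i _ =>
      norm_inv_one_sub_cpow_le (p i).2.two_le hz).trans_eq
      (by rw [Finset.prod_const, Finset.card_univ])
  obtain ⟨R, hR, hvR⟩ := exists_rank_le_norm_offDiagonal_sub_le hv (ε := ε) hb hbC fun s =>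
    (hbound _ (re_linePoint _ _)).trans (by
      rw [hε]
      gcongr
      exact pow_div_factorial_le _ k)
  have hgd : DifferentiableOn ℂ (eulerNumerator p) {z : ℂ | z.re < 1} :=
    (differentiable_eulerNumerator p).differentiableOn
  have hgL : MemLp (fun s : ℝ => eulerNumerator p (linePoint (1 / 2) s)) ∞ volume :=
    memLp_top_line ((differentiable_eulerNumerator p).continuous.comp (continuous_linePoint _))
      fun z hz => norm_eulerNumerator_le p hz.le
  have hfun : (fun s : ℝ => localRatio .archimedean (linePoint (1 / 2) s) *
      ∏ i, localRatio (.prime (p i)) (linePoint (1 / 2) s)) = fun s =>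
      (localRatio .archimedean (linePoint (1 / 2) s) *
        ∏ i, (1 - ((p i : ℕ) : ℂ) ^ (-linePoint (1 / 2) s))⁻¹) *
          eulerNumerator p (linePoint (1 / 2) s) := by
    funext s
    rw [eulerNumerator, mul_assoc, ← Finset.prod_mul_distrib]
    simp_rw [localRatio_prime]
  have hvg := hu
  rw [hfun] at hvg
  have hoff : offDiagonal (hu.toLp _) = offDiagonal (hv.toLp _) ∘L
      multiplication (hgL.toLp _) ∘L hardyProjection := by
    rw [← offDiagonal_mul_holomorphic hv hgd (fun z hz => norm_eulerNumerator_le p hz) hgL hvg]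
    congr 1
    exact MemLp.toLp_congr _ _ (Eventually.of_forall fun s => congrFun hfun s)
  -- Composing with a bounded operator on the right does not raise the rank and costs the factor `2
  -- ^ m` bounding the numerators.
  refine ⟨R ∘L multiplication (hgL.toLp _) ∘L hardyProjection, ?_, ?_⟩
  · exact (LinearMap.rank_comp_le_left _ _).trans hR
  · rw [hoff, ← ContinuousLinearMap.sub_comp]
    refine (ContinuousLinearMap.opNorm_comp_le _ _).trans ?_
    refine mul_le_mul hvR ?_ (norm_nonneg _) hε0
    have hP : ‖hardyProjection‖ ≤ 1 := Submodule.starProjection_norm_le _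
    have hM : ‖multiplication (hgL.toLp _)‖ ≤ 2 ^ Fintype.card ι :=
      (norm_multiplication_le _).trans (norm_toLp_top_le _ (by positivity) fun s =>
        norm_eulerNumerator_le p (re_linePoint _ _).le)
    calc _ ≤ ‖multiplication (hgL.toLp _)‖ * ‖hardyProjection‖ :=
          ContinuousLinearMap.opNorm_comp_le _ _
      _ ≤ 2 ^ Fintype.card ι * 1 := by gcongr
      _ = 2 ^ Fintype.card ι := mul_one _

theorem memLp_ratio (p : ι → Nat.Primes) :
    MemLp (fun s : ℝ => localRatio .archimedean (linePoint (1 / 2) s) *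
      ∏ i, localRatio (.prime (p i)) (linePoint (1 / 2) s)) ∞ volume := by
  refine memLp_top_line (C := 1) (b := fun z => localRatio .archimedean z *
    ∏ i, localRatio (.prime (p i)) z) ?_ fun z hz => ?_
  · have h := (continuous_localRatio_archimedean.mul (continuous_prod_inv p)).mul
      ((differentiable_eulerNumerator p).continuous.comp (continuous_linePoint (1 / 2)))
    refine h.congr fun s => ?_
    simp_rw [localRatio_prime, Finset.prod_mul_distrib, ← mul_assoc]
    rfl
  · rw [norm_mul, norm_localRatio_archimedean hz, norm_prod]
    simp [norm_localRatio_prime _ hz]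

/-! ### Orders of decay -/

theorem half_pow_isBigO_rpow_neg (α : ℝ) :
    (fun n : ℕ => (1 / 2 : ℝ) ^ n) =O[atTop] fun n : ℕ => (n : ℝ) ^ (-α) := by
  have h := (isLittleO_exp_neg_mul_rpow_atTop (Real.log_pos one_lt_two) (-α)).isBigO.comp_tendsto
    tendsto_natCast_atTop_atTop
  refine h.congr_left fun n => ?_
  simp only [Function.comp_apply]
  rw [mul_comm, Real.exp_nat_mul, Real.exp_neg, Real.exp_log two_pos, one_div]

theorem isInfinitesimalOfOrder_of_isEmpty [IsEmpty ι] (p : ι → Nat.Primes)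
    (hu : MemLp (fun s : ℝ => localRatio .archimedean (linePoint (1 / 2) s) *
      ∏ i, localRatio (.prime (p i)) (linePoint (1 / 2) s)) ∞ volume) {α : ℝ} (hα : 0 < α) :
    IsInfinitesimalOfOrder α (offDiagonal (hu.toLp _)) := by
  obtain ⟨C, hC⟩ := (half_pow_isBigO_rpow_neg α).bound
  refine isInfinitesimalOfOrder_of_approx (C := 8 * 2 ^ 26 * C) hα ?_
  filter_upwards [hC, eventually_ge_atTop 13] with n hn hn13
  -- Without primes there is no truncation error, so `X = 1` is fixed and the rank `n` serves only
  -- to shrink `2 ^ (-n)`.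
  obtain ⟨R, hR, hle⟩ := exists_rank_le_norm_offDiagonal_ratio_sub_le p hu (X := 1) (k := n)
    le_rfl (by simpa using hn13)
  refine ⟨R, hR, hle.trans ?_⟩
  rw [Real.norm_of_nonneg (by positivity), Real.norm_of_nonneg (by positivity)] at hn
  simp only [Fintype.card_of_isEmpty, Nat.cast_zero, zero_mul, zero_add, pow_zero, Nat.cast_one,
    one_mul, mul_one, pow_one]
  linarith

/-- With `k = 32 Q` the factor `2 ^ (26 Q)` is beaten, leaving `2 ^ (-6 Q)`. Even `2 ^ (-2 Q) ≤ Q ^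
(-2)` would suffice to bring the pole error below the truncation error `X ^ (-1/2)`. -/
theorem remainder_le {X Q : ℕ} (hX : 1 ≤ X) (hXQ : X ≤ Q) :
    (Q : ℝ) * (8 * ((2 ^ 26 : ℝ) ^ Q * (1 / 2) ^ (32 * Q))) ≤ 8 * (X : ℝ) ^ (-(1 / 2) : ℝ) := by
  have hX' : (1 : ℝ) ≤ X := by exact_mod_cast hX
  have hXQ' : (X : ℝ) ≤ Q := by exact_mod_cast hXQ
  have h1 : (2 ^ 26 : ℝ) ^ Q * (1 / 2) ^ (32 * Q) = ((2 : ℝ) ^ Q)⁻¹ ^ 6 := by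
    rw [pow_mul, ← mul_pow, ← inv_pow, ← pow_mul, mul_comm Q 6, pow_mul]
    norm_num
  have h2 : (Q : ℝ) ≤ 2 ^ Q := by exact_mod_cast Nat.lt_two_pow_self.le
  have hQ : (0 : ℝ) < Q := by linarith
  have h3 : ((2 : ℝ) ^ Q)⁻¹ ≤ (Q : ℝ)⁻¹ := by gcongr
  have h4 : ((2 : ℝ) ^ Q)⁻¹ ^ 6 ≤ ((2 : ℝ) ^ Q)⁻¹ ^ 2 :=
    pow_le_pow_of_le_one (by positivity) (inv_le_one_of_one_le₀ (one_le_pow₀ one_le_two))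
      (by norm_num)
  rw [h1]
  calc (Q : ℝ) * (8 * ((2 : ℝ) ^ Q)⁻¹ ^ 6) ≤ Q * (8 * (Q : ℝ)⁻¹ ^ 2) := by
        gcongr
        exact h4.trans (by gcongr)
    _ = 8 * (Q : ℝ)⁻¹ := by field_simp
    _ ≤ 8 * (X : ℝ)⁻¹ := by gcongr
    _ ≤ 8 * (X : ℝ) ^ (-(1 / 2) : ℝ) := by
        rw [← Real.rpow_neg_one]
        gcongr 8 * ?_
        exact Real.rpow_le_rpow_of_exponent_le hX' (by norm_num)

/-- The integer part `X` of `(n / 32) ^ (1 / m)`. -/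
theorem exists_root {m n : ℕ} (hm : 0 < m) (hn : 32 ≤ n) :
    ∃ X : ℕ, 1 ≤ X ∧ 32 * X ^ m ≤ n ∧ (X : ℝ) ^ (-(1 / 2) : ℝ) ≤
      2 ^ (1 / 2 : ℝ) * 32 ^ (1 / (2 * (m : ℝ))) * (n : ℝ) ^ (-(1 / (2 * (m : ℝ)))) := by
  have hm' : (0 : ℝ) < m := by exact_mod_cast hm
  have hn' : (32 : ℝ) ≤ n := by exact_mod_cast hn
  set t : ℝ := ((n : ℝ) / 32) ^ (1 / (m : ℝ)) with ht
  have ht1 : 1 ≤ t := Real.one_le_rpow (by linarith) (by positivity)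
  have hX : 1 ≤ ⌊t⌋₊ := Nat.one_le_floor_iff t |>.2 ht1
  have hX' : (1 : ℝ) ≤ ⌊t⌋₊ := by exact_mod_cast hX
  refine ⟨⌊t⌋₊, hX, ?_, ?_⟩
  · have h1 : ((⌊t⌋₊ : ℝ)) ^ m ≤ n / 32 := by
      calc ((⌊t⌋₊ : ℝ)) ^ m ≤ t ^ m := by
            gcongr
            exact Nat.floor_le (by linarith)
        _ = n / 32 := by
            rw [ht, ← Real.rpow_natCast, ← Real.rpow_mul (by positivity),
              one_div_mul_cancel hm'.ne', Real.rpow_one]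
    have h2 : (32 : ℝ) * (⌊t⌋₊ : ℝ) ^ m ≤ n := by linarith
    exact_mod_cast h2
  -- Since `⌊t⌋₊ ≥ 1`, rounding down loses at most a factor `2`, the source of `2 ^ (1 / 2)`.
  · have h1 : t / 2 ≤ ⌊t⌋₊ := by linarith [Nat.lt_floor_add_one t]
    have hn0 : (0 : ℝ) < n := by linarith
    calc (⌊t⌋₊ : ℝ) ^ (-(1 / 2) : ℝ) ≤ (t / 2) ^ (-(1 / 2) : ℝ) :=
          Real.rpow_le_rpow_of_nonpos (by linarith) h1 (by norm_num)
      _ = 2 ^ (1 / 2 : ℝ) * t ^ (-(1 / 2) : ℝ) := by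
          rw [Real.div_rpow (by linarith) (by norm_num), Real.rpow_neg (by norm_num : (0 : ℝ) ≤ 2),
            div_inv_eq_mul, mul_comm]
      _ = _ := by
          rw [ht, ← Real.rpow_mul (by positivity), show 1 / (m : ℝ) * -(1 / 2) =
            -(1 / (2 * (m : ℝ))) by field_simp, Real.div_rpow hn0.le (by norm_num),
            Real.rpow_neg (by norm_num : (0 : ℝ) ≤ 32), div_inv_eq_mul]
          ring

theorem isInfinitesimalOfOrder_of_nonempty [Nonempty ι] (p : ι → Nat.Primes)
    (hu : MemLp (fun s : ℝ => localRatio .archimedean (linePoint (1 / 2) s) *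
      ∏ i, localRatio (.prime (p i)) (linePoint (1 / 2) s)) ∞ volume) :
    IsInfinitesimalOfOrder (1 / (2 * (Fintype.card ι : ℝ))) (offDiagonal (hu.toLp _)) := by
  have hm : 0 < Fintype.card ι := Fintype.card_pos
  set m : ℕ := Fintype.card ι with hmdef
  refine isInfinitesimalOfOrder_of_approx (C := (m * 8 ^ m * 4 + 8) * 2 ^ m *
    (2 ^ (1 / 2 : ℝ) * 32 ^ (1 / (2 * (m : ℝ))))) (by positivity) ?_
  filter_upwards [eventually_ge_atTop 32] with n hn
  obtain ⟨X, hX, hXn, hXr⟩ := exists_root hm hn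
  -- The rank `32 X ^ m` is at most `n`, and `X ^ (-1/2)` is at most a constant times `n ^ (-1 /
  -- (2m))`.
  obtain ⟨R, hR, hle⟩ := exists_rank_le_norm_offDiagonal_ratio_sub_le p hu (X := X)
    (k := 32 * X ^ m) hX (Nat.mul_le_mul_right _ (by norm_num))
  refine ⟨R, hR.trans (by exact_mod_cast hXn), hle.trans ?_⟩
  have hrem := remainder_le hX (Nat.le_self_pow hm.ne' X)
  rw [← hmdef]
  calc (m * 8 ^ m * (4 * (X : ℝ) ^ (-(1 / 2) : ℝ)) +
        (X ^ m : ℕ) * (8 * ((2 ^ 26 : ℝ) ^ (X ^ m) * (1 / 2) ^ (32 * X ^ m)))) * 2 ^ m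
      ≤ (m * 8 ^ m * (4 * (X : ℝ) ^ (-(1 / 2) : ℝ)) + 8 * (X : ℝ) ^ (-(1 / 2) : ℝ)) * 2 ^ m := by
        gcongr
    _ = (m * 8 ^ m * 4 + 8) * 2 ^ m * (X : ℝ) ^ (-(1 / 2) : ℝ) := by ring
    _ ≤ (m * 8 ^ m * 4 + 8) * 2 ^ m * (2 ^ (1 / 2 : ℝ) * 32 ^ (1 / (2 * (m : ℝ))) *
          (n : ℝ) ^ (-(1 / (2 * (m : ℝ))))) := by gcongr
    _ = _ := by ring

end RatioProduct

/-! ### From finite sets of places to families of primes -/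

theorem Place.prime_injective : Function.Injective Place.prime := fun p q h => by
  injection h

theorem exists_ratioProduct_eq {F : Finset Place} (hF : Place.archimedean ∈ F) :
    ∃ S : Finset Nat.Primes, F.card = S.card + 1 ∧ ∀ z, ratioProduct F z =
      localRatio .archimedean z * ∏ p : S, localRatio (.prime p) z := by
  classical
  set S : Finset Nat.Primes := F.preimage Place.prime Place.prime_injective.injOn
  have hS : F.erase .archimedean = S.map ⟨Place.prime, Place.prime_injective⟩ := by
    ext v
    cases v with
    | archimedean => simp
    | prime p => simp [S]
  refine ⟨S, ?_, fun z => ?_⟩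
  · rw [← Finset.card_erase_add_one hF, hS, Finset.card_map]
  · rw [ratioProduct, ← Finset.mul_prod_erase F _ hF, hS, Finset.prod_map,
      Finset.prod_coe_sort S fun p => localRatio (.prime p) z]
    rfl

end QuasiInner

open QuasiInner in
theorem mainTheorem1 (F : Finset QuasiInner.Place) (hF : QuasiInner.Place.archimedean ∈ F)
    (m : ℕ) (hm : F.card = m + 1) :
    ∃ hu : MemLp (fun s : ℝ => QuasiInner.ratioProduct F (QuasiInner.linePoint (1 / 2) s)) ∞
        (volume : Measure ℝ),
      QuasiInner.IsQuasiInner (hu.toLp _) ∧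
      (0 < m → QuasiInner.IsInfinitesimalOfOrder (1 / (2 * (m : ℝ)))
        (QuasiInner.offDiagonal (hu.toLp _))) ∧
      (m = 0 → ∀ α : ℝ, 0 < α → QuasiInner.IsInfinitesimalOfOrder α
        (QuasiInner.offDiagonal (hu.toLp _))) := by
  obtain ⟨S, hS, hprod⟩ := exists_ratioProduct_eq hF
  obtain rfl : m = S.card := by omega
  simp_rw [hprod]
  have hu := memLp_ratio fun p : S => (p : Nat.Primes)
  have hpos : 0 < S.card → IsInfinitesimalOfOrder (1 / (2 * (S.card : ℝ)))
      (offDiagonal (hu.toLp _)) := fun h => by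
    have : Nonempty S := (Finset.card_pos.1 h).to_subtype
    simpa using isInfinitesimalOfOrder_of_nonempty (fun p : S => (p : Nat.Primes)) hu
  have hzero : S.card = 0 → ∀ α : ℝ, 0 < α → IsInfinitesimalOfOrder α
      (offDiagonal (hu.toLp _)) := fun h α hα => by
    have : IsEmpty S := Finset.isEmpty_coe_sort.2 (Finset.card_eq_zero.1 h)
    exact isInfinitesimalOfOrder_of_isEmpty (fun p : S => (p : Nat.Primes)) hu hα
  refine ⟨hu, ⟨?_, ?_⟩, hpos, hzero⟩
  · filter_upwards [hu.coeFn_toLp] with s hs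
    rw [hs, norm_mul, norm_localRatio_archimedean (re_linePoint _ _), norm_prod,
      one_mul]
    exact Finset.prod_eq_one fun p _ => norm_localRatio_prime p (re_linePoint _ _)
  -- Compactness is part of being an infinitesimal; for `m = 0` any positive order will do.
  · rcases Nat.eq_zero_or_pos S.card with h | h
    · exact (hzero h 1 one_pos).1
    · exact (hpos h).1
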